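/- Let $n\ge 1$ and let $P\in\mathbb C[x]$ be a monic polynomial of degree $n$ all of whose roots $\alpha$ satisfy $|\operatorname{Re}\alpha|<\tfrac12$. Let $\mathcal A=\mathcal A_P$ be the $\mathbb C$-algebra generated by $u,v,z$ with relations $$[z,u]=-u,\qquad [z,v]=v,\qquad vu=P\big(z-\tfrac12\big),\qquad uv=P\big(z+\tfrac12\big).$$ For $t\in\mathbb C^\times$ let $g_t$ be the automorphism of $\mathcal A$ with $g_t(v)=tv$, $g_t(u)=t^{-1}u$, $g_t(z)=z$. Let $\rho$ be an antilinear ring automorphism of $\mathcal A$ of the form $\rho(v)=\lambda u$, $\rho(u)=\lambda_* v$, $\rho(z)=-z$ with $\lambda,\lambda_*\in\mathbb C^\times$. Assume that $\rho^2=g_t$ with $t=e^{2\pi i c}$, $c\in[0,1)$, and that $\varepsilon:=i^n e^{\pi i c}\lambda\in\{1,-1\}$ (so $\rho=\rho_\varepsilon$). Let $\mathcal C_+$ be the cone of positive definite Hermitian forms $(\cdot,\cdot)$ on $\mathcal A$ (linear in the first and antilinear in the second argument) that are $\rho$-invariant, i.e. $(a\rho(y),b)=(a,yb)$ for all $a,b,y\in\mathcal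 A$. (i) The map $(\cdot,\cdot)\mapsto T$, $T(a)=(a,1)$, is an isomorphism (a bijection respecting addition and multiplication by positive reals) from $\mathcal C_+$ onto the cone of linear maps $T:\mathcal A\to\mathbb C$ such that $T(ab)=T(b\,g_t(a))$ and $T(\rho(a))=\overline{T(a)}$ for all $a,b$, and $T(a\rho(a))>0$ for all $a\ne0$; its inverse is $(a,b)=T(a\rho(b))$. (ii) The cone $\mathcal C_+$ is isomorphic to the cone of nonzero real polynomials $G(X)$ of degree $\le n-1$, with $G(0)=0$ if $c=0$, such that 1. if $\varepsilon=-1$, then $G(X)\ge 0$ for $X>0$ and $G(X)\le 0$ for $X<0$; 2. if $\varepsilon=1$, then $G(X)\ge 0$ for all $X\in\mathbb R$. More precisely, an isomorphism is given by the correspondence between forms in $\mathcal C_+$ and such polynomials $G$ in which $$(R(z),1)=\int_{i\mathbb R}R(x)\,e^{2\pi i c x}\,\frac{G(e^{2\pi i x})}{\mathbf P(e^{2\pi i x})}\,|dx|\qquad\text{for all }R\in\mathbb C[x],$$ where $\mathbf P(X)=\prod_{j=1}^n\big(X+e^{2\pi i\alpha_j}\big)$, $\alpha_1,\dots,\alpha_n$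 are the roots of $P$ with multiplicity, and the integral converges absolutely. -/

import Mathlib

open Polynomial

noncomputable section

namespace Kleinian

/-- The three generators `u`, `v`, `z`. -/
inductive Gen : Type
  | u
  | v
  | z

/-- The defining relations
`[z,u] = -u`, `[z,v] = v`, `vu = P(z - 1/2)`, `uv = P(z + 1/2)`. -/
inductive Rel (P : ℂ[X]) : FreeAlgebra ℂ Gen → FreeAlgebra ℂ Gen → Prop
  | zu : Rel P
      (FreeAlgebra.ι ℂ Gen.z * FreeAlgebra.ι ℂ Gen.u
        - FreeAlgebra.ι ℂ Gen.u * FreeAlgebra.ι ℂ Gen.z)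
      (-FreeAlgebra.ι ℂ Gen.u)
  | zv : Rel P
      (FreeAlgebra.ι ℂ Gen.z * FreeAlgebra.ι ℂ Gen.v
        - FreeAlgebra.ι ℂ Gen.v * FreeAlgebra.ι ℂ Gen.z)
      (FreeAlgebra.ι ℂ Gen.v)
  | vu : Rel P
      (FreeAlgebra.ι ℂ Gen.v * FreeAlgebra.ι ℂ Gen.u)
      (aeval (FreeAlgebra.ι ℂ Gen.z - algebraMap ℂ (FreeAlgebra ℂ Gen) (1 / 2)) P)
  | uv : Rel P
      (FreeAlgebra.ι ℂ Gen.u * FreeAlgebra.ι ℂ Gen.v)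
      (aeval (FreeAlgebra.ι ℂ Gen.z + algebraMap ℂ (FreeAlgebra ℂ Gen) (1 / 2)) P)

/-- The algebra `𝒜_P`: the quantization with parameter `P` of the Kleinian singularity of
type `A_{n-1}`, `n = deg P` (a generalized Weyl algebra). -/
def QAlg (P : ℂ[X]) : Type := RingQuot (Rel P)

instance (P : ℂ[X]) : Ring (QAlg P) := inferInstanceAs (Ring (RingQuot (Rel P)))

instance (P : ℂ[X]) : Algebra ℂ (QAlg P) := inferInstanceAs (Algebra ℂ (RingQuot (Rel P)))

/-- The image in `𝒜_P` of a generator. -/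
def gen (P : ℂ[X]) (i : Gen) : QAlg P :=
  RingQuot.mkAlgHom ℂ (Rel P) (FreeAlgebra.ι ℂ i)

def u (P : ℂ[X]) : QAlg P := gen P Gen.u

def v (P : ℂ[X]) : QAlg P := gen P Gen.v

def z (P : ℂ[X]) : QAlg P := gen P Gen.z

theorem z_mul_u (P : ℂ[X]) : z P * u P - u P * z P = -u P := by
  have h := RingQuot.mkAlgHom_rel ℂ (Rel.zu (P := P))
  rw [map_sub, map_mul, map_mul, map_neg] at h
  exact h

theorem z_mul_v (P : ℂ[X]) : z P * v P - v P * z P = v P := by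
  have h := RingQuot.mkAlgHom_rel ℂ (Rel.zv (P := P))
  rw [map_sub, map_mul, map_mul] at h
  exact h

theorem v_mul_u (P : ℂ[X]) :
    v P * u P = aeval (z P - algebraMap ℂ (QAlg P) (1 / 2)) P := by
  have h := RingQuot.mkAlgHom_rel ℂ (Rel.vu (P := P))
  rw [map_mul, ← aeval_algHom_apply, map_sub, AlgHom.commutes] at h
  exact h

theorem u_mul_v (P : ℂ[X]) :
    u P * v P = aeval (z P + algebraMap ℂ (QAlg P) (1 / 2)) P := by
  have h := RingQuot.mkAlgHom_rel ℂ (Rel.uv (P := P))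
  rw [map_mul, ← aeval_algHom_apply, map_add, AlgHom.commutes] at h
  exact h

/-- Values of `g_t` on the generators. -/
def twistGen (P : ℂ[X]) (t : ℂˣ) : Gen → QAlg P
  | Gen.u => ((t⁻¹ : ℂˣ) : ℂ) • u P
  | Gen.v => (t : ℂ) • v P
  | Gen.z => z P

/-- The automorphism `g_t = t^{ad z}` of `𝒜_P`, with `g_t(v) = t v`, `g_t(u) = t⁻¹ u`,
`g_t(z) = z`. -/
def twist (P : ℂ[X]) (t : ℂˣ) : QAlg P →ₐ[ℂ] QAlg P :=
  RingQuot.liftAlgHom ℂ (s := Rel P)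
    ⟨FreeAlgebra.lift ℂ (twistGen P t), by
      intro x y h
      cases h with
      | zu =>
        simp only [map_sub, map_mul, map_neg, FreeAlgebra.lift_ι_apply, twistGen,
          mul_smul_comm, smul_mul_assoc]
        rw [← smul_sub, z_mul_u, smul_neg]
      | zv =>
        simp only [map_sub, map_mul, FreeAlgebra.lift_ι_apply, twistGen,
          mul_smul_comm, smul_mul_assoc]
        rw [← smul_sub, z_mul_v]
      | vu =>
        simp only [map_mul, ← aeval_algHom_apply, map_sub, AlgHom.commutes,
          FreeAlgebra.lift_ι_apply, twistGen, mul_smul_comm, smul_mul_assoc, smul_smul]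
        rw [v_mul_u]
        simp
      | uv =>
        simp only [map_mul, ← aeval_algHom_apply, map_add, AlgHom.commutes,
          FreeAlgebra.lift_ι_apply, twistGen, mul_smul_comm, smul_mul_assoc, smul_smul]
        rw [u_mul_v]
        simp⟩

/-- The complex number `t = exp (2πic)`, as a unit. -/
def tOf (c : ℝ) : ℂˣ :=
  Units.mk0 (Complex.exp (2 * Real.pi * Complex.I * c)) (Complex.exp_ne_zero _)

/-- A conjugation of `𝒜_P`: an antilinear ring automorphism `ρ` with
`ρ(v) = λ u`, `ρ(u) = λ_* v`, `ρ(z) = -z`, where `λ, λ_* ∈ ℂˣ`. -/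
structure Conjugation (P : ℂ[X]) where
  toRingEquiv : QAlg P ≃+* QAlg P
  map_smul' : ∀ (r : ℂ) (a : QAlg P),
    toRingEquiv (r • a) = (starRingEnd ℂ) r • toRingEquiv a
  lam : ℂ
  lamStar : ℂ
  lam_ne_zero : lam ≠ 0
  lamStar_ne_zero : lamStar ≠ 0
  map_v : toRingEquiv (v P) = lam • u P
  map_u : toRingEquiv (u P) = lamStar • v P
  map_z : toRingEquiv (z P) = -z P

instance (P : ℂ[X]) : CoeFun (Conjugation P) (fun _ => QAlg P → QAlg P) :=
  ⟨fun ρ => ρ.toRingEquiv⟩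

/-- Sesquilinear forms on `𝒜_P`, linear in the first and antilinear in the second variable. -/
abbrev SesqForm (P : ℂ[X]) : Type :=
  QAlg P →ₗ[ℂ] QAlg P →ₛₗ[starRingEnd ℂ] ℂ

/-- The cone `𝒞₊` of positive definite Hermitian forms `(·,·)` on `𝒜_P` that are
`ρ`-invariant: `(a ρ(y), b) = (a, y b)`. -/
def positiveForms {P : ℂ[X]} (ρ : Conjugation P) : ConvexCone ℝ (SesqForm P) where
  carrier := {B | (∀ a b, B b a = (starRingEnd ℂ) (B a b)) ∧
    (∀ a b y, B (a * ρ y) b = B a (y * b)) ∧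
    (∀ a, a ≠ 0 → 0 < (B a a).re)}
  smul_mem' := by
    rintro r hr B ⟨h1, h2, h3⟩
    refine ⟨fun a b => ?_, fun a b y => ?_, fun a ha => ?_⟩
    · simp [h1 a b]
    · simp [h2 a b y]
    · simpa using mul_pos hr (h3 a ha)
  add_mem' := by
    rintro B ⟨h1, h2, h3⟩ B' ⟨h1', h2', h3'⟩
    refine ⟨fun a b => ?_, fun a b y => ?_, fun a ha => ?_⟩
    · simp [h1 a b, h1' a b]
    · simp [h2 a b y, h2' a b y]
    · simpa using add_pos (h3 a ha) (h3' a ha)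

/-- The cone of positive `ρ`-equivariant `g_t`-twisted traces: linear maps `T : 𝒜_P → ℂ` with
`T(ab) = T(b g_t(a))`, `T(ρ(a))` the complex conjugate of `T(a)`, and `T(a ρ(a)) > 0` for
all nonzero `a`. -/
def positiveTraces {P : ℂ[X]} (ρ : Conjugation P) (t : ℂˣ) :
    ConvexCone ℝ (QAlg P →ₗ[ℂ] ℂ) where
  carrier := {T | (∀ a b, T (a * b) = T (b * twist P t a)) ∧
    (∀ a, T (ρ a) = (starRingEnd ℂ) (T a)) ∧
    (∀ a, a ≠ 0 → 0 < (T (a * ρ a)).re ∧ (T (a * ρ a)).im = 0)}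
  smul_mem' := by
    rintro r hr T ⟨h1, h2, h3⟩
    refine ⟨fun a b => ?_, fun a => ?_, fun a ha => ⟨?_, ?_⟩⟩
    · simp [h1 a b]
    · simp [h2 a]
    · simpa using mul_pos hr (h3 a ha).1
    · simp [(h3 a ha).2]
  add_mem' := by
    rintro T ⟨h1, h2, h3⟩ T' ⟨h1', h2', h3'⟩
    refine ⟨fun a b => ?_, fun a => ?_, fun a ha => ⟨?_, ?_⟩⟩
    · simp [h1 a b, h1' a b]
    · simp [h2 a, h2' a]
    · simpa using add_pos (h3 a ha).1 (h3' a ha).1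
    · simp [(h3 a ha).2, (h3' a ha).2]

theorem eq_zero_of_add_eq_zero {G H : ℝ[X]} (hG : ∀ x : ℝ, 0 < x → 0 ≤ G.eval x)
    (hH : ∀ x : ℝ, 0 < x → 0 ≤ H.eval x) (h : G + H = 0) : G = 0 := by
  refine Polynomial.eq_zero_of_infinite_isRoot G
    (Set.Infinite.mono (s := Set.Ioi (0 : ℝ)) (fun x hx => ?_) (Set.Ioi_infinite 0))
  have h1 := congrArg (Polynomial.eval x) h
  rw [eval_add, eval_zero] at h1
  have h2 := hG x hx
  have h3 := hH x hx
  change G.eval x = 0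
  linarith

/-- The cone of nonzero polynomials `G` of degree `≤ n - 1` with `G(0) = 0` if `c = 0`, such
that: if `ε = -1`, then `G ≥ 0` on `X > 0` and `G ≤ 0` on `X < 0`; if `ε = 1`, then `G ≥ 0`
on `ℝ`. -/
def polyCone (n : ℕ) (c : ℝ) (ε : ℤˣ) : ConvexCone ℝ ℝ[X] where
  carrier := {G | G ≠ 0 ∧ G.degree < n ∧ (c = 0 → G.eval 0 = 0) ∧
    (ε = -1 → (∀ x : ℝ, 0 < x → 0 ≤ G.eval x) ∧ (∀ x : ℝ, x < 0 → G.eval x ≤ 0)) ∧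
    (ε = 1 → ∀ x : ℝ, 0 ≤ G.eval x)}
  smul_mem' := by
    rintro r hr G ⟨h0, hd, hc, hm, hp⟩
    refine ⟨smul_ne_zero hr.ne' h0, lt_of_le_of_lt (degree_smul_le _ _) hd,
      fun h => by simp [hc h], fun h => ⟨fun x hx => ?_, fun x hx => ?_⟩, fun h x => ?_⟩
    · rw [eval_smul, smul_eq_mul]
      exact mul_nonneg hr.le ((hm h).1 x hx)
    · rw [eval_smul, smul_eq_mul]
      exact mul_nonpos_of_nonneg_of_nonpos hr.le ((hm h).2 x hx)
    · rw [eval_smul, smul_eq_mul]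
      exact mul_nonneg hr.le (hp h x)
  add_mem' := by
    rintro G ⟨h0, hd, hc, hm, hp⟩ H ⟨h0', hd', hc', hm', hp'⟩
    refine ⟨fun h => h0 ?_, lt_of_le_of_lt (degree_add_le _ _) (max_lt hd hd'),
      fun h => by simp [hc h, hc' h], fun h => ⟨fun x hx => ?_, fun x hx => ?_⟩, fun h x => ?_⟩
    · rcases Int.units_eq_one_or ε with hε | hε
      · exact eq_zero_of_add_eq_zero (fun x _ => hp hε x) (fun x _ => hp' hε x) h
      · exact eq_zero_of_add_eq_zero (hm hε).1 (hm' hε).1 h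
    · rw [eval_add]
      exact add_nonneg ((hm h).1 x hx) ((hm' h).1 x hx)
    · rw [eval_add]
      exact add_nonpos ((hm h).2 x hx) ((hm' h).2 x hx)
    · rw [eval_add]
      exact add_nonneg (hp h x) (hp' h x)

/-- An isomorphism of convex cones: a bijection that respects addition and multiplication by
positive real numbers. -/
structure ConeIso {E F : Type*} [AddCommGroup E] [Module ℝ E] [AddCommGroup F] [Module ℝ F]
    (C : ConvexCone ℝ E) (D : ConvexCone ℝ F) where
  toEquiv : {x : E // x ∈ C} ≃ {y : F // y ∈ D}
  map_add' : ∀ x y : {x : E // x ∈ C},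
    (toEquiv ⟨x.1 + y.1, C.add_mem x.2 y.2⟩ : F) = (toEquiv x : F) + (toEquiv y : F)
  map_smul' : ∀ (r : ℝ) (hr : 0 < r) (x : {x : E // x ∈ C}),
    (toEquiv ⟨r • x.1, C.smul_mem hr x.2⟩ : F) = r • (toEquiv x : F)

/-- The polynomial `𝐏(X) = ∏ⱼ (X + exp (2πi αⱼ))`, where the `αⱼ` are the roots of `P` with
multiplicities. -/
def boldP (P : ℂ[X]) : ℂ[X] :=
  (P.roots.map fun α => X + C (Complex.exp (2 * Real.pi * Complex.I * α))).prod

/-- The weight function `w(x) = exp (2πicx) G(exp (2πix)) / 𝐏(exp (2πix))`. -/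
def weight (P : ℂ[X]) (c : ℝ) (G : ℝ[X]) (x : ℂ) : ℂ :=
  Complex.exp (2 * Real.pi * Complex.I * c * x)
    * aeval (Complex.exp (2 * Real.pi * Complex.I * x)) G
    / (boldP P).eval (Complex.exp (2 * Real.pi * Complex.I * x))

end Kleinian

end

/-!
The argument rests on the `ℤ`-grading of `𝒜_P` by the adjoint action of `z`. The difference operator
representation `rep` shows that `𝒜_P` is free over `ℂ[z]` on the powers of `u` and `v`
(`coeffEquiv`).

A `ρ`-invariant form is determined by `T(a) = (a, 1)`, as `(a, b) = T(a ρ(b))`; the Hermitian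
symmetry of the form becomes the twisted trace property together with compatibility with `ρ`
(`formTrace_mem`, `traceForm_mem`). A twisted trace vanishes on nonzero weights, so it amounts to a
functional `τ` on `ℂ[z]` such that `τ(S(x - 1) P(x - 1/2)) = t τ(S(x) P(x + 1/2))` for all `S`
(`IsTwistedTrace.isTraceFunctional`, `isTwistedTrace_extendTrace`).

Such functionals are integrals over the imaginary axis. The weight
`w(x) = e^{2πicx} G(e^{2πix}) / 𝐏(e^{2πix})` satisfies `w(x + 1) = t w(x)`, and `P(x) w(x + 1/2)` is
holomorphic and exponentially decaying in the strip `|Re x| ≤ 1/2`: its only possible poles there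
are the roots of `P`, where `P` cancels them. Moving the contour across the strip gives the trace
condition (`isTraceFunctional_weightFunctional`). Conversely, `G` is determined by the functional,
since an exponentially decaying function is determined by its moments
(`ae_eq_zero_of_moments_eq_zero`), while the trace condition leaves at most as many parameters as
`G` has (`IsTraceFunctional.eq_zero`); so every trace functional is an integral
(`exists_weightFunctional_eq`).

For positivity, the identity `T(xy ρ(xy)) = T(y ρ(x) ρ(y ρ(x)))` (`trace_mul_conjugation_swap`)
with `x = v` or `x = u` reduces all weights to weights `0` and `1` (`trace_mul_conjugation_pos`).
There the values of the trace are `∫ |R|² w` and `λ ∫ |R(x + 1/2)|² P(x) w(x + 1/2)` over the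
imaginary axis. The roots of `P` are symmetric under `α ↦ -conj α`; pairing them shows that the
densities have the signs of `G(X)` for `X > 0` and of `ε G(X)` for `X < 0` (`boldP_pos`,
`rootProd_pos`). Conditions on the signs of `G` therefore suffice for positivity, and they are
necessary because polynomials are dense in `L²` of an exponentially decaying weight
(`range_polyLp_topologicalClosure`, `nonneg_of_integral_normSq_mul_nonneg`).
-/

noncomputable section

namespace Kleinian

/-! ### Structure of the algebra -/

theorem v_mul_z (P : ℂ[X]) : v P * z P = (z P - 1) * v P := by
  have h := z_mul_v P
  rw [sub_mul, one_mul, ← sub_eq_zero]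
  rw [← sub_eq_zero] at h
  rw [← neg_eq_zero, ← h]
  abel

theorem u_mul_z (P : ℂ[X]) : u P * z P = (z P + 1) * u P := by
  have h := z_mul_u P
  rw [add_mul, one_mul, ← sub_eq_zero]
  rw [← sub_eq_zero] at h
  rw [← neg_eq_zero, ← h]
  abel

theorem mul_aeval_of_semiconj {A : Type*} [Ring A] [Algebra ℂ A] {a x y : A}
    (h : a * x = y * a) (R : ℂ[X]) : a * aeval x R = aeval y R * a := by
  induction R using Polynomial.induction_on' with
  | add p q hp hq => rw [map_add, map_add, mul_add, add_mul, hp, hq]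
  | monomial n r =>
    have hs : SemiconjBy a x y := h
    rw [aeval_monomial, aeval_monomial, mul_assoc, ← (hs.pow_right n).eq, ← mul_assoc,
      ← mul_assoc, Algebra.commutes]

theorem v_mul_aeval (P R : ℂ[X]) :
    v P * aeval (z P) R = aeval (z P) (R.comp (X - 1)) * v P := by
  rw [mul_aeval_of_semiconj (v_mul_z P), aeval_comp]
  simp

theorem u_mul_aeval (P R : ℂ[X]) :
    u P * aeval (z P) R = aeval (z P) (R.comp (X + 1)) * u P := by
  rw [mul_aeval_of_semiconj (u_mul_z P), aeval_comp]
  simp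

theorem v_mul_u_eq_aeval (P : ℂ[X]) : v P * u P = aeval (z P) (P.comp (X - C (1 / 2))) := by
  rw [v_mul_u, aeval_comp]
  simp

theorem u_mul_v_eq_aeval (P : ℂ[X]) : u P * v P = aeval (z P) (P.comp (X + C (1 / 2))) := by
  rw [u_mul_v, aeval_comp]
  simp

theorem gen_induction {P : ℂ[X]} {p : QAlg P → Prop} (hc : ∀ r : ℂ, p (algebraMap ℂ _ r))
    (hu : p (u P)) (hv : p (v P)) (hz : p (z P)) (hmul : ∀ a b, p a → p b → p (a * b))
    (hadd : ∀ a b, p a → p b → p (a + b)) (a : QAlg P) : p a := by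
  obtain ⟨x, rfl⟩ := RingQuot.mkAlgHom_surjective ℂ (Rel P) a
  induction x using FreeAlgebra.induction with
  | grade0 r => rw [AlgHom.commutes]; exact hc r
  | grade1 i => cases i <;> assumption
  | mul a b ha hb => rw [map_mul]; exact hmul _ _ ha hb
  | add a b ha hb => rw [map_add]; exact hadd _ _ ha hb

/-- The monomial of weight `k`: a power of `v` for `k ≥ 0`, a power of `u` for `k < 0`. -/
def weightGen (P : ℂ[X]) : ℤ → QAlg P
  | Int.ofNat m => v P ^ m
  | Int.negSucc m => u P ^ (m + 1)

@[simp] theorem weightGen_zero (P : ℂ[X]) : weightGen P 0 = 1 := pow_zero (v P)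

theorem weightGen_natCast (P : ℂ[X]) (m : ℕ) : weightGen P m = v P ^ m := rfl

theorem weightGen_neg_natCast (P : ℂ[X]) (m : ℕ) : weightGen P (-m) = u P ^ m := by
  cases m with
  | zero => simp
  | succ m => rfl

/-- The elements `∑ₖ Rₖ(z) eₖ`, where `eₖ` is the monomial of weight `k`. -/
def ofCoeffs (P : ℂ[X]) : (ℤ →₀ ℂ[X]) →ₗ[ℂ] QAlg P :=
  Finsupp.lsum ℂ fun k => LinearMap.mulRight ℂ (weightGen P k) ∘ₗ (aeval (z P)).toLinearMap

@[simp] theorem ofCoeffs_single (P : ℂ[X]) (k : ℤ) (R : ℂ[X]) :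
    ofCoeffs P (Finsupp.single k R) = aeval (z P) R * weightGen P k := by
  simp [ofCoeffs]

theorem v_mul_weightGen (P : ℂ[X]) (k : ℤ) :
    ∃ S : ℂ[X], v P * weightGen P k = aeval (z P) S * weightGen P (k + 1) := by
  rcases Int.le_total 0 k with hk | hk
  · obtain ⟨m, rfl⟩ := Int.eq_ofNat_of_zero_le hk
    refine ⟨1, ?_⟩
    rw [weightGen_natCast, ← Nat.cast_succ, weightGen_natCast, pow_succ', map_one, one_mul]
  · obtain ⟨m, hm⟩ := Int.eq_ofNat_of_zero_le (neg_nonneg.2 hk)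
    obtain rfl : k = -(m : ℤ) := by omega
    cases m with
    | zero => exact ⟨1, by simpa using (weightGen_natCast P 1).symm⟩
    | succ m =>
      refine ⟨P.comp (X - C (1 / 2)), ?_⟩
      rw [weightGen_neg_natCast, pow_succ', ← mul_assoc, v_mul_u_eq_aeval,
        show -((m + 1 : ℕ) : ℤ) + 1 = -(m : ℤ) by push_cast; ring, weightGen_neg_natCast]

theorem u_mul_weightGen (P : ℂ[X]) (k : ℤ) :
    ∃ S : ℂ[X], u P * weightGen P k = aeval (z P) S * weightGen P (k - 1) := by
  rcases lt_or_ge 0 k with hk | hk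
  · obtain ⟨m, rfl⟩ := Int.eq_succ_of_zero_lt hk
    refine ⟨P.comp (X + C (1 / 2)), ?_⟩
    rw [← Nat.cast_succ, weightGen_natCast, pow_succ', ← mul_assoc, u_mul_v_eq_aeval,
      show ((m + 1 : ℕ) : ℤ) - 1 = (m : ℤ) by push_cast; ring, weightGen_natCast]
  · obtain ⟨m, hm⟩ := Int.eq_ofNat_of_zero_le (neg_nonneg.2 hk)
    obtain rfl : k = -(m : ℤ) := by omega
    refine ⟨1, ?_⟩
    rw [show -(m : ℤ) - 1 = -((m + 1 : ℕ) : ℤ) by push_cast; ring, weightGen_neg_natCast,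
      weightGen_neg_natCast, pow_succ', map_one, one_mul]

/-- The span of the elements `R(z) eₖ` is a left ideal; as it contains `1`, it is all of `𝒜_P`. -/
theorem mul_mem_range_ofCoeffs (P : ℂ[X]) (a : QAlg P) :
    ∀ b ∈ LinearMap.range (ofCoeffs P), a * b ∈ LinearMap.range (ofCoeffs P) := by
  have key : ∀ a : QAlg P, (∀ (k : ℤ) (R : ℂ[X]), a * (aeval (z P) R * weightGen P k) ∈
      LinearMap.range (ofCoeffs P)) → ∀ b ∈ LinearMap.range (ofCoeffs P),
      a * b ∈ LinearMap.range (ofCoeffs P) := by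
    rintro a h _ ⟨f, rfl⟩
    induction f using Finsupp.induction_linear with
    | zero => simp
    | add f g hf hg => rw [map_add, mul_add]; exact add_mem hf hg
    | single k R => rw [ofCoeffs_single]; exact h k R
  have mem : ∀ R k, aeval (z P) R * weightGen P k ∈ LinearMap.range (ofCoeffs P) :=
    fun R k => ⟨Finsupp.single k R, ofCoeffs_single P k R⟩
  induction a using gen_induction with
  | hc r =>
    intro b hb
    rw [← Algebra.smul_def]
    exact Submodule.smul_mem _ r hb
  | hu =>
    refine key _ fun k R => ?_
    obtain ⟨S, hS⟩ := u_mul_weightGen P k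
    rw [← mul_assoc, u_mul_aeval, mul_assoc, hS, ← mul_assoc, ← map_mul]
    exact mem _ _
  | hv =>
    refine key _ fun k R => ?_
    obtain ⟨S, hS⟩ := v_mul_weightGen P k
    rw [← mul_assoc, v_mul_aeval, mul_assoc, hS, ← mul_assoc, ← map_mul]
    exact mem _ _
  | hz =>
    refine key _ fun k R => ?_
    have : z P * aeval (z P) R = aeval (z P) (X * R) := by simp
    rw [← mul_assoc, this]
    exact mem _ _
  | hmul a b ha hb => intro c hc; rw [mul_assoc]; exact ha _ (hb _ hc)
  | hadd a b ha hb => intro c hc; rw [add_mul]; exact add_mem (ha _ hc) (hb _ hc)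

theorem ofCoeffs_surjective (P : ℂ[X]) : Function.Surjective (ofCoeffs P) := fun a => by
  have h := mul_mem_range_ofCoeffs P a 1
    ⟨Finsupp.single 0 1, by simp⟩
  rwa [mul_one] at h

/-- Multiplication operator on functions. -/
abbrev mulOp (h : ℂ → ℂ) : Module.End ℂ (ℂ → ℂ) := Algebra.lmul ℂ (ℂ → ℂ) h

theorem mulOp_apply (h f : ℂ → ℂ) (x : ℂ) : mulOp h f x = h x * f x := rfl

theorem aeval_mulOp (h : ℂ → ℂ) (R : ℂ[X]) (f : ℂ → ℂ) (x : ℂ) :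
    aeval (mulOp h) R f x = R.eval (h x) * f x := by
  rw [mulOp, aeval_algHom_apply]
  simp

/-- The action of the generators on functions: `z` multiplies by the coordinate, `v` is the unit
shift and `u` is a multiple of the inverse shift. -/
def repGen (P : ℂ[X]) : Gen → Module.End ℂ (ℂ → ℂ)
  | Gen.u => mulOp (fun x => P.eval (x + 1 / 2)) * LinearMap.funLeft ℂ ℂ (fun x => x + 1)
  | Gen.v => LinearMap.funLeft ℂ ℂ (fun x => x - 1)
  | Gen.z => mulOp id

/-- The action of `𝒜_P` on functions by difference operators. -/
def rep (P : ℂ[X]) : QAlg P →ₐ[ℂ] Module.End ℂ (ℂ → ℂ) :=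
  RingQuot.liftAlgHom ℂ (s := Rel P)
    ⟨FreeAlgebra.lift ℂ (repGen P), by
      have key : ∀ a : ℂ, mulOp id + algebraMap ℂ _ a = mulOp (fun x => x + a) := fun a => by
        ext f x
        simp [mulOp_apply, add_mul, Algebra.algebraMap_eq_smul_one]
      have key' : ∀ a : ℂ, mulOp id - algebraMap ℂ _ a = mulOp (fun x => x - a) := fun a => by
        ext f x
        simp [mulOp_apply, sub_mul, Algebra.algebraMap_eq_smul_one]
      intro x y h
      cases h with
      | zu =>
        simp only [map_sub, map_mul, map_neg, FreeAlgebra.lift_ι_apply, repGen]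
        ext f x
        simp [mulOp_apply, LinearMap.funLeft_apply]
        ring
      | zv =>
        simp only [map_sub, map_mul, FreeAlgebra.lift_ι_apply, repGen]
        ext f x
        simp [mulOp_apply, LinearMap.funLeft_apply]
        ring
      | vu =>
        simp only [map_mul, ← aeval_algHom_apply, map_sub, AlgHom.commutes,
          FreeAlgebra.lift_ι_apply, repGen, key']
        ext f x
        rw [aeval_mulOp]
        simp [mulOp_apply, LinearMap.funLeft_apply]
        ring_nf
        simp
      | uv =>
        simp only [map_mul, ← aeval_algHom_apply, map_add, AlgHom.commutes,
          FreeAlgebra.lift_ι_apply, repGen, key]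
        ext f x
        rw [aeval_mulOp]
        simp [mulOp_apply, LinearMap.funLeft_apply]⟩

theorem rep_gen (P : ℂ[X]) (i : Gen) : rep P (gen P i) = repGen P i := by
  have : rep P (gen P i) = FreeAlgebra.lift ℂ (repGen P) (FreeAlgebra.ι ℂ i) :=
    RingQuot.liftAlgHom_mkAlgHom_apply ..
  rw [this, FreeAlgebra.lift_ι_apply]

theorem rep_aeval_z (P R : ℂ[X]) (f : ℂ → ℂ) (x : ℂ) :
    rep P (aeval (z P) R) f x = R.eval x * f x := by
  rw [← aeval_algHom_apply, z, rep_gen]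
  exact aeval_mulOp id R f x

theorem rep_v (P : ℂ[X]) (f : ℂ → ℂ) (x : ℂ) : rep P (v P) f x = f (x - 1) := by
  rw [v, rep_gen]; rfl

theorem rep_u (P : ℂ[X]) (f : ℂ → ℂ) (x : ℂ) :
    rep P (u P) f x = P.eval (x + 1 / 2) * f (x + 1) := by
  rw [u, rep_gen]; rfl

theorem comp_X_add_C_ne_zero {P : ℂ[X]} (hP : P ≠ 0) (a : ℂ) : P.comp (X + C a) ≠ 0 := by
  rwa [Ne, Polynomial.comp_X_add_C_eq_zero_iff]

/-- The monomial of weight `k` acts as the shift by `k` followed by a nonzero polynomial factor, so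
different weights are separated by their action on point masses. -/
theorem rep_weightGen {P : ℂ[X]} (hP : P ≠ 0) (k : ℤ) :
    ∃ q : ℂ[X], q ≠ 0 ∧ ∀ f x, rep P (weightGen P k) f x = q.eval x * f (x - k) := by
  rcases Int.le_total 0 k with hk | hk
  · obtain ⟨m, rfl⟩ := Int.eq_ofNat_of_zero_le hk
    refine ⟨1, one_ne_zero, ?_⟩
    rw [weightGen_natCast]
    induction m with
    | zero => simp
    | succ m ih =>
      intro f x
      rw [pow_succ', map_mul, Module.End.mul_apply, rep_v, ih (Int.natCast_nonneg m)]
      simp only [eval_one]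
      congr 2
      push_cast
      ring
  · obtain ⟨m, hm⟩ := Int.eq_ofNat_of_zero_le (neg_nonneg.2 hk)
    obtain rfl : k = -(m : ℤ) := by omega
    rw [weightGen_neg_natCast]
    clear hk hm
    induction m with
    | zero => exact ⟨1, one_ne_zero, by simp⟩
    | succ m ih =>
      obtain ⟨q, hq, h⟩ := ih
      refine ⟨P.comp (X + C (1 / 2)) * q.comp (X + C 1), mul_ne_zero (comp_X_add_C_ne_zero hP _)
        (comp_X_add_C_ne_zero hq _), fun f x => ?_⟩
      rw [pow_succ', map_mul, Module.End.mul_apply, rep_u, h]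
      simp only [eval_mul, eval_comp, eval_add, eval_X, eval_C, mul_assoc]
      congr 3
      push_cast
      ring

/-- Linear independence of the elements `R(z) eₖ`: applied to the point mass at `x - k` and
evaluated at `x`, only the component of weight `k` survives. -/
theorem ofCoeffs_injective {P : ℂ[X]} (hP : P ≠ 0) : Function.Injective (ofCoeffs P) := by
  rw [injective_iff_map_eq_zero]
  intro f hf
  ext1 k
  choose q hq hrep using fun k => rep_weightGen hP k
  have hz : ∀ (g : ℤ →₀ ℂ[X]) (x : ℂ),
      rep P (ofCoeffs P g) (Pi.single (x - k) 1) x = (g k * q k).eval x := by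
    intro g x
    induction g using Finsupp.induction_linear with
    | zero => simp
    | add f g hf hg =>
      rw [map_add, map_add, LinearMap.add_apply, Pi.add_apply, hf, hg]
      simp [add_mul]
    | single j R =>
      rw [ofCoeffs_single, map_mul, Module.End.mul_apply, rep_aeval_z, hrep]
      by_cases h : j = k
      · subst h; simp
      · have : x - (j : ℂ) ≠ x - k := fun h' => h (by
          have := sub_right_injective h'
          exact_mod_cast this)
        rw [Pi.single_eq_of_ne this, Finsupp.single_eq_of_ne (Ne.symm h)]
        simp
  have h0 : f k * q k = 0 := Polynomial.funext fun x => by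
    rw [← hz, hf]; simp
  simpa [hq k] using h0

/-- `𝒜_P` is free over `ℂ[z]` on the monomials of weight `k ∈ ℤ`. -/
def coeffEquiv {P : ℂ[X]} (hP : P ≠ 0) : (ℤ →₀ ℂ[X]) ≃ₗ[ℂ] QAlg P :=
  LinearEquiv.ofBijective (ofCoeffs P) ⟨ofCoeffs_injective hP, ofCoeffs_surjective P⟩

theorem coeffEquiv_symm {P : ℂ[X]} (hP : P ≠ 0) (k : ℤ) (R : ℂ[X]) :
    (coeffEquiv hP).symm (aeval (z P) R * weightGen P k) = Finsupp.single k R := by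
  rw [LinearEquiv.symm_apply_eq]
  exact (ofCoeffs_single P k R).symm

theorem aeval_z_injective {P : ℂ[X]} (hP : P ≠ 0) :
    Function.Injective (aeval (z P) : ℂ[X] → QAlg P) := fun R S h => by
  have := congrArg (coeffEquiv hP).symm (congrArg (· * weightGen P 0) h)
  simp only [coeffEquiv_symm] at this
  exact Finsupp.single_injective 0 this

/-- To prove an additive property on `𝒜_P` it suffices to check it on the elements `R(z) eₖ`. -/
theorem span_induction {P : ℂ[X]} {p : QAlg P → Prop}
    (hadd : ∀ a b, p a → p b → p (a + b))
    (h : ∀ (k : ℤ) (R : ℂ[X]), p (aeval (z P) R * weightGen P k)) (a : QAlg P) : p a := by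
  obtain ⟨f, rfl⟩ := ofCoeffs_surjective P a
  induction f using Finsupp.induction_linear with
  | zero => simpa using h 0 0
  | add f g hf hg => rw [map_add]; exact hadd _ _ hf hg
  | single k R => rw [ofCoeffs_single]; exact h k R

/-- Elements of weight `k` for the adjoint action of `z`. -/
def HasWeight {P : ℂ[X]} (a : QAlg P) (k : ℤ) : Prop := z P * a - a * z P = (k : ℂ) • a

theorem HasWeight.mul {P : ℂ[X]} {a b : QAlg P} {k l : ℤ} (ha : HasWeight a k)
    (hb : HasWeight b l) : HasWeight (a * b) (k + l) := by
  unfold HasWeight at *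
  calc z P * (a * b) - a * b * z P
      = (z P * a - a * z P) * b + a * (z P * b - b * z P) := by noncomm_ring
    _ = _ := by rw [ha, hb]; push_cast; rw [add_smul, smul_mul_assoc, mul_smul_comm]

theorem hasWeight_aeval {P : ℂ[X]} (R : ℂ[X]) : HasWeight (aeval (z P) R) 0 := by
  have h : z P * aeval (z P) R = aeval (z P) R * z P := by
    have := mul_aeval_of_semiconj (A := QAlg P) (a := z P) (x := z P) rfl R
    exact this
  simp [HasWeight, h]

theorem hasWeight_v (P : ℂ[X]) : HasWeight (v P) 1 := by simp [HasWeight, z_mul_v]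

theorem hasWeight_u (P : ℂ[X]) : HasWeight (u P) (-1) := by simp [HasWeight, z_mul_u]

theorem HasWeight.pow {P : ℂ[X]} {a : QAlg P} {k : ℤ} (ha : HasWeight a k) (m : ℕ) :
    HasWeight (a ^ m) (m * k) := by
  induction m with
  | zero => simpa using hasWeight_aeval (P := P) 1
  | succ m ih =>
    have := ih.mul ha
    rw [pow_succ]
    convert this using 1
    push_cast; ring

theorem hasWeight_weightGen (P : ℂ[X]) (k : ℤ) : HasWeight (weightGen P k) k := by
  rcases Int.le_total 0 k with hk | hk
  · obtain ⟨m, rfl⟩ := Int.eq_ofNat_of_zero_le hk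
    simpa [weightGen_natCast] using (hasWeight_v P).pow m
  · obtain ⟨m, hm⟩ := Int.eq_ofNat_of_zero_le (neg_nonneg.2 hk)
    obtain rfl : k = -(m : ℤ) := by omega
    rw [weightGen_neg_natCast]
    simpa using (hasWeight_u P).pow m

theorem hasWeight_aeval_mul_weightGen (P R : ℂ[X]) (k : ℤ) :
    HasWeight (aeval (z P) R * weightGen P k) k := by
  simpa using (hasWeight_aeval R).mul (hasWeight_weightGen P k)

/-! ### Conjugations and twisted traces -/

section TwistedTraces

open scoped ComplexOrder ComplexConjugate

/-- The polynomial `x ↦ conj (R (-conj x))`; on the imaginary axis it is the pointwise conjugate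
of `R`. -/
def skewConj (R : ℂ[X]) : ℂ[X] := (R.map (starRingEnd ℂ)).comp (-X)

theorem eval_skewConj (R : ℂ[X]) (x : ℂ) : (skewConj R).eval x = conj (R.eval (-conj x)) := by
  rw [skewConj, eval_comp, eval_neg, eval_X]
  have := Polynomial.eval_map_apply (p := R) (f := starRingEnd ℂ) (-conj x)
  rw [← this]
  simp

theorem skewConj_eval_ofReal_mul_I (R : ℂ[X]) (y : ℝ) :
    (skewConj R).eval (y * Complex.I) = conj (R.eval (y * Complex.I)) := by
  rw [eval_skewConj]
  simp

variable {P : ℂ[X]}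

@[simp] theorem twist_gen (t : ℂˣ) (i : Gen) : twist P t (gen P i) = twistGen P t i := by
  have : twist P t (gen P i) = FreeAlgebra.lift ℂ (twistGen P t) (FreeAlgebra.ι ℂ i) :=
    RingQuot.liftAlgHom_mkAlgHom_apply ..
  rw [this, FreeAlgebra.lift_ι_apply]

theorem twist_v (t : ℂˣ) : twist P t (v P) = (t : ℂ) • v P := twist_gen t Gen.v

theorem twist_u (t : ℂˣ) : twist P t (u P) = ((t⁻¹ : ℂˣ) : ℂ) • u P := twist_gen t Gen.u

theorem twist_z (t : ℂˣ) : twist P t (z P) = z P := twist_gen t Gen.z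

theorem Conjugation.map_mul (ρ : Conjugation P) (a b : QAlg P) : ρ (a * b) = ρ a * ρ b :=
  _root_.map_mul ρ.toRingEquiv a b

theorem Conjugation.map_add (ρ : Conjugation P) (a b : QAlg P) : ρ (a + b) = ρ a + ρ b :=
  _root_.map_add ρ.toRingEquiv a b

theorem Conjugation.map_smul (ρ : Conjugation P) (r : ℂ) (a : QAlg P) :
    ρ (r • a) = conj r • ρ a := ρ.map_smul' r a

theorem Conjugation.map_one (ρ : Conjugation P) : ρ (1 : QAlg P) = 1 :=
  _root_.map_one ρ.toRingEquiv

theorem Conjugation.map_aeval (ρ : Conjugation P) (R : ℂ[X]) :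
    ρ (aeval (z P) R) = aeval (z P) (skewConj R) := by
  induction R using Polynomial.induction_on' with
  | add p q hp hq =>
    rw [_root_.map_add, ρ.map_add, hp, hq, ← _root_.map_add, skewConj, skewConj, skewConj,
      Polynomial.map_add, add_comp]
  | monomial n r =>
    rw [aeval_monomial, ← Algebra.smul_def, ρ.map_smul, _root_.map_pow ρ.toRingEquiv, ρ.map_z,
      skewConj, map_monomial, monomial_comp, _root_.map_mul, aeval_C, _root_.map_pow,
      _root_.map_neg, aeval_X, ← Algebra.smul_def]

theorem HasWeight.conjugation {a : QAlg P} {k : ℤ} (ha : HasWeight a k) (ρ : Conjugation P) :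
    HasWeight (ρ a) (-k) := by
  unfold HasWeight at *
  have h := congrArg ρ.toRingEquiv ha
  rw [map_sub, _root_.map_mul, _root_.map_mul, ρ.map_smul', ρ.map_z, map_intCast] at h
  rw [Int.cast_neg, neg_smul, ← h]
  noncomm_ring

/-- Up to a nonzero factor, `P` is invariant under `skewConj`. -/
theorem Conjugation.skewConj_eq (ρ : Conjugation P) (hP : P ≠ 0) :
    skewConj P = C (ρ.lam * ρ.lamStar) * P := by
  have h := congrArg ρ.toRingEquiv (v_mul_u_eq_aeval P)
  rw [_root_.map_mul, ρ.map_v, ρ.map_u, ρ.map_aeval, smul_mul_smul_comm, u_mul_v_eq_aeval,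
    ← _root_.map_smul] at h
  have h' := aeval_z_injective hP h
  refine Polynomial.funext fun x => ?_
  have h2 := congrArg (eval (x - 1 / 2)) h'
  rw [eval_skewConj, eval_smul, eval_comp, eval_comp] at h2
  simp only [eval_add, eval_sub, eval_X, eval_C, sub_add_cancel, smul_eq_mul] at h2
  rw [eval_mul, eval_C, h2, eval_skewConj]
  congr 2
  simp only [map_sub, map_div₀, _root_.map_one, map_ofNat]
  ring

/-- The roots of `P` are symmetric about the imaginary axis, with multiplicities. -/
theorem Conjugation.map_neg_conj_roots (ρ : Conjugation P) (hP : P ≠ 0) :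
    P.roots.map (fun α => -conj α) = P.roots := by
  have h2 : (skewConj P).roots = P.roots := by
    rw [ρ.skewConj_eq hP, roots_C_mul _ (mul_ne_zero ρ.lam_ne_zero ρ.lamStar_ne_zero)]
  ext x
  have hx : -conj (-conj x) = x := by simp
  have hinj : Function.Injective fun α : ℂ => -conj α :=
    neg_injective.comp (RingHom.injective _)
  conv_lhs => rw [← hx]
  conv_rhs => rw [← h2]
  rw [Multiset.count_map_eq_count' _ _ hinj, count_roots, count_roots, skewConj,
    show (-X : ℂ[X]) = C (-1) * X + C 0 by simp, rootMultiplicity_comp_C_mul_X_add_C _ _ _ _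
      (by simp), eq_rootMultiplicity_map (RingHom.injective (starRingEnd ℂ))]
  simp

theorem v_pow_mul_aeval (m : ℕ) (R : ℂ[X]) :
    v P ^ m * aeval (z P) R = aeval (z P) (R.comp (X - C (m : ℂ))) * v P ^ m := by
  induction m generalizing R with
  | zero => simp
  | succ m ih =>
    rw [pow_succ, mul_assoc, v_mul_aeval, ← mul_assoc, ih, mul_assoc, comp_assoc]
    congr 3
    simp [sub_sub]

theorem u_pow_mul_aeval (m : ℕ) (R : ℂ[X]) :
    u P ^ m * aeval (z P) R = aeval (z P) (R.comp (X + C (m : ℂ))) * u P ^ m := by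
  induction m generalizing R with
  | zero => simp
  | succ m ih =>
    rw [pow_succ, mul_assoc, u_mul_aeval, ← mul_assoc, ih, mul_assoc, comp_assoc]
    congr 3
    simp [add_assoc]

/-- A trace that is not twisted on `z` vanishes on nonzero weights, since there `[z, ·]` is
invertible. It is thus determined by its restriction to `ℂ[z]`. -/
theorem trace_eq_zero_of_hasWeight {T : QAlg P →ₗ[ℂ] ℂ} (hT : ∀ b, T (z P * b) = T (b * z P))
    {b : QAlg P} {k : ℤ} (hb : HasWeight b k) (hk : k ≠ 0) : T b = 0 := by
  have h := congrArg T hb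
  rw [map_sub, hT, sub_self, map_smul, smul_eq_mul] at h
  simpa [hk] using h.symm

/-- `T (a b) = T (b g_t(a))`. -/
def IsTwistedTrace (t : ℂˣ) (T : QAlg P →ₗ[ℂ] ℂ) : Prop :=
  ∀ a b, T (a * b) = T (b * twist P t a)

theorem IsTwistedTrace.z_comm {t : ℂˣ} {T : QAlg P →ₗ[ℂ] ℂ} (hT : IsTwistedTrace t T)
    (b : QAlg P) : T (z P * b) = T (b * z P) := by rw [hT, twist_z]

theorem v_mul_aeval_mul_u (S : ℂ[X]) : v P * (aeval (z P) S * u P) =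
    aeval (z P) (S.comp (X - 1) * P.comp (X - C (1 / 2))) := by
  rw [← mul_assoc, v_mul_aeval, mul_assoc, v_mul_u_eq_aeval, ← map_mul]

theorem u_mul_aeval_mul_v (S : ℂ[X]) : u P * (aeval (z P) S * v P) =
    aeval (z P) (S.comp (X + 1) * P.comp (X + C (1 / 2))) := by
  rw [← mul_assoc, u_mul_aeval, mul_assoc, u_mul_v_eq_aeval, ← map_mul]

/-- The condition on the restriction `τ` of a linear functional to `ℂ[z]` that characterises
`g_t`-twisted traces. -/
def IsTraceFunctional (P : ℂ[X]) (t : ℂˣ) (τ : ℂ[X] →ₗ[ℂ] ℂ) : Prop :=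
  ∀ S : ℂ[X], τ (S.comp (X - 1) * P.comp (X - C (1 / 2))) = t * τ (S * P.comp (X + C (1 / 2)))

theorem IsTwistedTrace.isTraceFunctional {t : ℂˣ} {T : QAlg P →ₗ[ℂ] ℂ}
    (hT : IsTwistedTrace t T) :
    IsTraceFunctional P t (T ∘ₗ (aeval (z P)).toLinearMap) := fun S => by
  have h := hT (v P) (aeval (z P) S * u P)
  rw [v_mul_aeval_mul_u, twist_v, mul_smul_comm, mul_assoc, u_mul_v_eq_aeval,
    ← map_mul, map_smul] at h
  exact h

theorem trace_ext {T T' : QAlg P →ₗ[ℂ] ℂ} (hT : ∀ b, T (z P * b) = T (b * z P))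
    (hT' : ∀ b, T' (z P * b) = T' (b * z P))
    (h : ∀ R : ℂ[X], T (aeval (z P) R) = T' (aeval (z P) R)) : T = T' := by
  ext a
  induction a using span_induction with
  | hadd a b ha hb => rw [map_add, map_add, ha, hb]
  | h k R =>
    by_cases hk : k = 0
    · subst hk; simpa using h R
    · rw [trace_eq_zero_of_hasWeight hT (hasWeight_aeval_mul_weightGen P R k) hk,
        trace_eq_zero_of_hasWeight hT' (hasWeight_aeval_mul_weightGen P R k) hk]

/-- The extension of a functional on `ℂ[z]` to `𝒜_P` by zero on all nonzero weights. -/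
def extendTrace (hP : P ≠ 0) (τ : ℂ[X] →ₗ[ℂ] ℂ) : QAlg P →ₗ[ℂ] ℂ :=
  τ ∘ₗ Finsupp.lapply 0 ∘ₗ (coeffEquiv hP).symm.toLinearMap

theorem extendTrace_aeval_mul_weightGen (hP : P ≠ 0) (τ : ℂ[X] →ₗ[ℂ] ℂ) (R : ℂ[X]) (k : ℤ) :
    extendTrace hP τ (aeval (z P) R * weightGen P k) = if k = 0 then τ R else 0 := by
  simp only [extendTrace, LinearMap.comp_apply, LinearEquiv.coe_coe, coeffEquiv_symm]
  by_cases hk : k = 0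
  · subst hk; simp
  · simp [hk]

theorem extendTrace_aeval (hP : P ≠ 0) (τ : ℂ[X] →ₗ[ℂ] ℂ) (R : ℂ[X]) :
    extendTrace hP τ (aeval (z P) R) = τ R := by
  simpa using extendTrace_aeval_mul_weightGen hP τ R 0

theorem extendTrace_z_comm (hP : P ≠ 0) (τ : ℂ[X] →ₗ[ℂ] ℂ) (b : QAlg P) :
    extendTrace hP τ (z P * b) = extendTrace hP τ (b * z P) := by
  induction b using span_induction with
  | hadd a b ha hb => rw [mul_add, add_mul, map_add, map_add, ha, hb]
  | h k R =>
    rw [← sub_eq_zero, ← map_sub, hasWeight_aeval_mul_weightGen P R k, map_smul,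
      extendTrace_aeval_mul_weightGen]
    by_cases hk : k = 0 <;> simp [hk]

/-- The trace identity `T(ab) = T(b g_t(a))` need only be checked for a generator `a` and for `b` of
the opposite weight. For `a = v` it is the trace condition on `ℂ[z]`, for `a = u` the same condition
read backwards. -/
theorem isTwistedTrace_extendTrace (hP : P ≠ 0) {t : ℂˣ} {τ : ℂ[X] →ₗ[ℂ] ℂ}
    (hτ : IsTraceFunctional P t τ) : IsTwistedTrace t (extendTrace hP τ) := by
  have hz := extendTrace_z_comm hP τ
  intro a
  induction a using gen_induction with
  | hc r =>
    intro b
    rw [AlgHom.commutes, Algebra.commutes]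
  | hz => intro b; rw [hz, twist_z]
  | hu =>
    intro b
    induction b using span_induction with
    | hadd a b ha hb => rw [mul_add, add_mul, map_add, map_add, ha, hb]
    | h k R =>
      have hw := hasWeight_aeval_mul_weightGen P R k
      rw [twist_u, mul_smul_comm, map_smul, smul_eq_mul]
      by_cases hk : k = 1
      · subst hk
        have hv : weightGen P 1 = v P := by simpa using weightGen_natCast P 1
        rw [hv, u_mul_aeval_mul_v, mul_assoc, v_mul_u_eq_aeval, ← map_mul, extendTrace_aeval,
          extendTrace_aeval]
        have h := hτ (R.comp (X + 1))
        rw [comp_assoc] at h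
        simp only [add_comp, X_comp, one_comp, sub_add_cancel, comp_X] at h
        rw [h, Units.inv_mul_cancel_left]
      · rw [trace_eq_zero_of_hasWeight hz ((hasWeight_u P).mul hw) (by omega),
          trace_eq_zero_of_hasWeight hz (hw.mul (hasWeight_u P)) (by omega), mul_zero]
  | hv =>
    intro b
    induction b using span_induction with
    | hadd a b ha hb => rw [mul_add, add_mul, map_add, map_add, ha, hb]
    | h k R =>
      have hw := hasWeight_aeval_mul_weightGen P R k
      rw [twist_v, mul_smul_comm, map_smul, smul_eq_mul]
      by_cases hk : k = -1
      · subst hk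
        have hu : weightGen P (-1) = u P := by simpa using weightGen_neg_natCast P 1
        rw [hu, v_mul_aeval_mul_u, mul_assoc, u_mul_v_eq_aeval, ← map_mul, extendTrace_aeval,
          extendTrace_aeval]
        exact hτ R
      · rw [trace_eq_zero_of_hasWeight hz ((hasWeight_v P).mul hw) (by omega),
          trace_eq_zero_of_hasWeight hz (hw.mul (hasWeight_v P)) (by omega), mul_zero]
  | hmul a b ha hb =>
    intro c
    rw [mul_assoc, ha, mul_assoc, hb, _root_.map_mul (twist P t), mul_assoc]
  | hadd a b ha hb =>
    intro c
    rw [add_mul, map_add, ha, hb, map_add, mul_add, map_add]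

/-- Compatibility of a trace with `ρ` need only be checked on `ℂ[z]`: `ρ` negates weights, so both
sides vanish on nonzero weights. -/
theorem trace_conjugation {T : QAlg P →ₗ[ℂ] ℂ} (hT : ∀ b, T (z P * b) = T (b * z P))
    (ρ : Conjugation P)
    (h : ∀ R : ℂ[X], T (aeval (z P) (skewConj R)) = conj (T (aeval (z P) R))) (a : QAlg P) :
    T (ρ a) = conj (T a) := by
  induction a using span_induction with
  | hadd a b ha hb => rw [ρ.map_add, map_add, map_add, map_add, ha, hb]
  | h k R =>
    by_cases hk : k = 0
    · subst hk
      rw [weightGen_zero, mul_one, ρ.map_aeval, h]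
    · have hw := hasWeight_aeval_mul_weightGen P R k
      rw [trace_eq_zero_of_hasWeight hT hw hk,
        trace_eq_zero_of_hasWeight hT (hw.conjugation ρ) (by omega), map_zero]

/-! ### Reduction of positivity to weights 0 and 1 -/

section Positivity

variable {ρ : Conjugation P} {t : ℂˣ} {T : QAlg P →ₗ[ℂ] ℂ}

/-- The twisted trace property moves a left factor `x` of `x y` to a right factor `ρ x` without
changing the square norm. For `x = v` this lowers the weight by two. -/
theorem trace_mul_conjugation_swap (hT : IsTwistedTrace t T) (hρ : ∀ a, ρ (ρ a) = twist P t a)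
    (x y : QAlg P) : T (x * y * ρ (x * y)) = T (y * ρ x * ρ (y * ρ x)) := by
  rw [ρ.map_mul, ρ.map_mul, mul_assoc, hT, hρ]
  simp only [mul_assoc]

theorem trace_smul_mul_conjugation (r : ℂ) (a : QAlg P) :
    T (r • a * ρ (r • a)) = (r * conj r) * T (a * ρ a) := by
  rw [ρ.map_smul, smul_mul_smul_comm, map_smul, smul_eq_mul]

theorem trace_smul_mul_conjugation_pos {r : ℂ} (hr : r ≠ 0) {a : QAlg P}
    (ha : 0 < T (a * ρ a)) : 0 < T (r • a * ρ (r • a)) := by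
  rw [trace_smul_mul_conjugation]
  refine mul_pos ?_ ha
  rw [Complex.mul_conj]
  exact_mod_cast Complex.normSq_pos.2 hr

/-- Swapping one factor `v` turns `R v ^ (m + 2)` into a multiple of `S v ^ m` with `S ≠ 0`. -/
theorem trace_v_pow_pos (hP : P ≠ 0) (hT : IsTwistedTrace t T)
    (hρ : ∀ a, ρ (ρ a) = twist P t a)
    (h0 : ∀ R : ℂ[X], R ≠ 0 → 0 < T (aeval (z P) R * ρ (aeval (z P) R)))
    (h1 : ∀ R : ℂ[X], R ≠ 0 → 0 < T (aeval (z P) R * v P * ρ (aeval (z P) R * v P))) (m : ℕ) :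
    ∀ R : ℂ[X], R ≠ 0 → 0 < T (aeval (z P) R * v P ^ m * ρ (aeval (z P) R * v P ^ m)) := by
  induction m using Nat.twoStepInduction with
  | zero => simpa using h0
  | one => simpa using h1
  | more m ih _ =>
    intro R hR
    have hx : aeval (z P) R * v P ^ (m + 2)
        = v P * (aeval (z P) (R.comp (X + C 1)) * v P ^ (m + 1)) := by
      rw [← mul_assoc, v_mul_aeval, comp_assoc, pow_succ' _ (m + 1), mul_assoc]
      simp
    have hy : aeval (z P) (R.comp (X + C 1)) * v P ^ (m + 1) * (ρ.lam • u P) = ρ.lam •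
        (aeval (z P) (R.comp (X + C 1) * (P.comp (X + C (-(1 / 2)))).comp (X + C (-(m : ℂ))))
          * v P ^ m) := by
      rw [mul_smul_comm, pow_succ, mul_assoc, mul_assoc, v_mul_u_eq_aeval, v_pow_mul_aeval,
        ← mul_assoc, ← map_mul]
      simp [sub_eq_add_neg]
    rw [hx, trace_mul_conjugation_swap hT hρ, ρ.map_v, hy]
    exact trace_smul_mul_conjugation_pos ρ.lam_ne_zero (ih _ (mul_ne_zero
      (comp_X_add_C_ne_zero hR _) (comp_X_add_C_ne_zero (comp_X_add_C_ne_zero hP _) _)))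

/-- Swapping one factor `u` turns `R u ^ (m + 2)` into a multiple of `S u ^ m`, and `R u` into a
multiple of `S v`, with `S ≠ 0`. -/
theorem trace_u_pow_pos (hP : P ≠ 0) (hT : IsTwistedTrace t T)
    (hρ : ∀ a, ρ (ρ a) = twist P t a)
    (h0 : ∀ R : ℂ[X], R ≠ 0 → 0 < T (aeval (z P) R * ρ (aeval (z P) R)))
    (h1 : ∀ R : ℂ[X], R ≠ 0 → 0 < T (aeval (z P) R * v P * ρ (aeval (z P) R * v P))) (m : ℕ) :
    ∀ R : ℂ[X], R ≠ 0 → 0 < T (aeval (z P) R * u P ^ m * ρ (aeval (z P) R * u P ^ m)) := by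
  have hx : ∀ (m : ℕ) (R : ℂ[X]), aeval (z P) R * u P ^ (m + 1)
      = u P * (aeval (z P) (R.comp (X + C (-1))) * u P ^ m) := fun m R => by
    rw [← mul_assoc, u_mul_aeval, comp_assoc, pow_succ', mul_assoc]
    simp
  induction m using Nat.twoStepInduction with
  | zero => simpa using h0
  | one =>
    intro R hR
    rw [hx 0, trace_mul_conjugation_swap hT hρ, ρ.map_u, pow_zero, mul_one, mul_smul_comm]
    exact trace_smul_mul_conjugation_pos ρ.lamStar_ne_zero (h1 _ (comp_X_add_C_ne_zero hR _))
  | more m ih _ =>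
    intro R hR
    have hy : aeval (z P) (R.comp (X + C (-1))) * u P ^ (m + 1) * (ρ.lamStar • v P) =
        ρ.lamStar •
        (aeval (z P) (R.comp (X + C (-1)) * (P.comp (X + C (1 / 2))).comp (X + C (m : ℂ)))
          * u P ^ m) := by
      rw [mul_smul_comm, pow_succ, mul_assoc, mul_assoc, u_mul_v_eq_aeval, u_pow_mul_aeval,
        ← mul_assoc, ← map_mul]
    rw [hx, trace_mul_conjugation_swap hT hρ, ρ.map_u, hy]
    exact trace_smul_mul_conjugation_pos ρ.lamStar_ne_zero (ih _ (mul_ne_zero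
      (comp_X_add_C_ne_zero hR _) (comp_X_add_C_ne_zero (comp_X_add_C_ne_zero hP _) _)))

/-- Components of different weights are orthogonal for `T(a ρ(b))`, so positivity can be checked on
each weight separately; the swaps reduce all weights to `0` and `1`. -/
theorem trace_mul_conjugation_pos (hP : P ≠ 0) (hT : IsTwistedTrace t T)
    (hρ : ∀ a, ρ (ρ a) = twist P t a)
    (h0 : ∀ R : ℂ[X], R ≠ 0 → 0 < T (aeval (z P) R * ρ (aeval (z P) R)))
    (h1 : ∀ R : ℂ[X], R ≠ 0 → 0 < T (aeval (z P) R * v P * ρ (aeval (z P) R * v P)))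
    {a : QAlg P} (ha : a ≠ 0) : 0 < T (a * ρ a) := by
  obtain ⟨f, rfl⟩ := ofCoeffs_surjective P a
  set b : ℤ → QAlg P := fun k => aeval (z P) (f k) * weightGen P k with hb
  have hw : ∀ k, HasWeight (b k) k := fun k => hasWeight_aeval_mul_weightGen P (f k) k
  have hf : ofCoeffs P f = ∑ k ∈ f.support, b k := by
    simp [ofCoeffs, Finsupp.sum, hb]
  have hf0 : f.support.Nonempty := by
    rw [Finsupp.support_nonempty_iff]
    rintro rfl
    exact ha (map_zero _)
  have hsum : T (ofCoeffs P f * ρ (ofCoeffs P f)) = ∑ k ∈ f.support, T (b k * ρ (b k)) := by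
    rw [hf, map_sum ρ.toRingEquiv, Finset.sum_mul_sum, map_sum]
    refine Finset.sum_congr rfl fun k hk => ?_
    rw [map_sum]
    refine Finset.sum_eq_single_of_mem k hk fun j _ hj => ?_
    exact trace_eq_zero_of_hasWeight hT.z_comm ((hw k).mul ((hw j).conjugation ρ)) (by omega)
  rw [hsum]
  refine Finset.sum_pos (fun k hk => ?_) hf0
  have hk' : f k ≠ 0 := Finsupp.mem_support_iff.1 hk
  rcases Int.le_total 0 k with h | h
  · obtain ⟨m, rfl⟩ := Int.eq_ofNat_of_zero_le h
    exact trace_v_pow_pos hP hT hρ h0 h1 m _ hk'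
  · obtain ⟨m, hm⟩ := Int.eq_ofNat_of_zero_le (neg_nonneg.2 h)
    obtain rfl : k = -(m : ℤ) := by omega
    simp only [hb, weightGen_neg_natCast]
    exact trace_u_pow_pos hP hT hρ h0 h1 m _ hk'

theorem aeval_mul_conjugation (ρ : Conjugation P) (R : ℂ[X]) :
    aeval (z P) R * ρ (aeval (z P) R) = aeval (z P) (R * skewConj R) := by
  rw [ρ.map_aeval, map_mul]

theorem aeval_mul_v_mul_conjugation (ρ : Conjugation P) (R : ℂ[X]) :
    aeval (z P) R * v P * ρ (aeval (z P) R * v P) = ρ.lam •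
      aeval (z P) (R * ((skewConj R).comp (X - 1) * P.comp (X - C (1 / 2)))) := by
  rw [ρ.map_mul, ρ.map_aeval, ρ.map_v, mul_smul_comm, mul_smul_comm, mul_assoc,
    v_mul_aeval_mul_u, ← map_mul]

end Positivity

end TwistedTraces

/-! ### Moments of exponentially decaying functions -/

section Moments

open MeasureTheory Complex
open scoped FourierTransform ContDiff

theorem integrable_exp_neg_mul_abs {δ : ℝ} (hδ : 0 < δ) :
    Integrable fun y : ℝ => Real.exp (-(δ * |y|)) := by
  refine (integrable_inv_one_add_sq.const_mul (1 + 2 / δ ^ 2)).mono' (by fun_prop)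
    (.of_forall fun y => ?_)
  rw [Real.norm_eq_abs, Real.abs_exp, Real.exp_neg, ← div_eq_mul_inv, inv_eq_one_div,
    div_le_div_iff₀ (Real.exp_pos _) (by positivity), one_mul]
  have h1 := Real.quadratic_le_exp_of_nonneg (mul_nonneg hδ.le (abs_nonneg y))
  have h2 : 0 ≤ δ * |y| := by positivity
  have h3 : 1 ≤ Real.exp (δ * |y|) := Real.one_le_exp h2
  have h4 : y ^ 2 ≤ 2 / δ ^ 2 * Real.exp (δ * |y|) := by
    rw [div_mul_eq_mul_div, le_div_iff₀ (by positivity)]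
    rw [mul_pow, sq_abs] at h1
    nlinarith
  linarith

theorem abs_pow_le_exp {δ : ℝ} (hδ : 0 < δ) (k : ℕ) (y : ℝ) :
    |y| ^ k ≤ k.factorial / δ ^ k * Real.exp (δ * |y|) := by
  have h := Real.pow_div_factorial_le_exp _ (mul_nonneg hδ.le (abs_nonneg y)) k
  rw [div_mul_eq_mul_div, le_div_iff₀ (by positivity), mul_comm, ← mul_pow]
  rw [div_le_iff₀ (by positivity)] at h
  linarith

/-- If `e^{δ|y|} g` is integrable and all moments of `g` vanish, then all moments of `e^{ihy} g`
vanish for `|h| < δ`: expand `e^{ihy}` in a power series. -/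
theorem moments_exp_mul_eq_zero {g : ℝ → ℂ} {δ h : ℝ} (hg : AEStronglyMeasurable g)
    (hint : Integrable fun y : ℝ => Real.exp (δ * |y|) * ‖g y‖) (hh : |h| < δ)
    (hm : ∀ k : ℕ, ∫ y : ℝ, (y : ℂ) ^ k * g y = 0) (k : ℕ) :
    ∫ y : ℝ, (y : ℂ) ^ k * (cexp (I * h * y) * g y) = 0 := by
  have hsum : HasSum (fun j : ℕ => ∫ y : ℝ, (y : ℂ) ^ k * ((I * h * y) ^ j / j.factorial * g y))
      (∫ y : ℝ, (y : ℂ) ^ k * (cexp (I * h * y) * g y)) := by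
    have hs : ∀ y : ℝ, HasSum (fun j : ℕ => |y| ^ k * ((|h| * |y|) ^ j / j.factorial * ‖g y‖))
        (|y| ^ k * (Real.exp (|h| * |y|) * ‖g y‖)) := fun y => by
      have := NormedSpace.expSeries_div_hasSum_exp (𝔸 := ℝ) (|h| * |y|)
      rw [← Real.exp_eq_exp_ℝ] at this
      exact (this.mul_right _).mul_left _
    refine hasSum_integral_of_dominated_convergence
      (fun j y => |y| ^ k * ((|h| * |y|) ^ j / j.factorial * ‖g y‖)) (fun j => ?_)
      (fun j => .of_forall fun y => ?_) (.of_forall fun y => (hs y).summable) ?_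
      (.of_forall fun y => ?_)
    · exact (by fun_prop : AEStronglyMeasurable (fun y : ℝ => (y : ℂ) ^ k)).mul
        ((by fun_prop : AEStronglyMeasurable
          (fun y : ℝ => (I * h * y : ℂ) ^ j / j.factorial)).mul hg)
    · simp
    · simp only [fun y => (hs y).tsum_eq]
      have hδ' : 0 < δ - |h| := by linarith
      refine (hint.const_mul (k.factorial / (δ - |h|) ^ k)).mono'
        ((by fun_prop : AEStronglyMeasurable (fun y : ℝ => |y| ^ k)).mul
        ((by fun_prop : AEStronglyMeasurable
          (fun y : ℝ => Real.exp (|h| * |y|))).mul hg.norm)) (.of_forall fun y => ?_)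
      rw [Real.norm_of_nonneg (by positivity)]
      calc |y| ^ k * (Real.exp (|h| * |y|) * ‖g y‖)
          ≤ (k.factorial / (δ - |h|) ^ k * Real.exp ((δ - |h|) * |y|)) *
            (Real.exp (|h| * |y|) * ‖g y‖) := by
              gcongr
              exact abs_pow_le_exp hδ' k y
        _ = k.factorial / (δ - |h|) ^ k * (Real.exp (δ * |y|) * ‖g y‖) := by
              rw [show δ * |y| = (δ - |h|) * |y| + |h| * |y| by ring, Real.exp_add]
              ring
    · have := NormedSpace.expSeries_div_hasSum_exp (𝔸 := ℂ) (I * h * y)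
      rw [← Complex.exp_eq_exp_ℂ] at this
      exact (this.mul_right _).mul_left _
  rw [← hsum.tsum_eq]
  refine (tsum_congr fun j => ?_).trans tsum_zero
  have : ∀ y : ℝ, (y : ℂ) ^ k * ((I * h * y) ^ j / j.factorial * g y)
      = ((I * h) ^ j / j.factorial) * ((y : ℂ) ^ (k + j) * g y) := fun y => by ring
  simp_rw [this]
  rw [integral_const_mul, hm, mul_zero]

/-- An exponentially decaying function is determined by its moments: multiplication by `e^{ihy}`
for small `h`, repeated, shows that the Fourier transform vanishes everywhere. -/
theorem ae_eq_zero_of_moments_eq_zero {g : ℝ → ℂ} {δ : ℝ} (hδ : 0 < δ)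
    (hg : AEStronglyMeasurable g) (hint : Integrable fun y : ℝ => Real.exp (δ * |y|) * ‖g y‖)
    (hm : ∀ k : ℕ, ∫ y : ℝ, (y : ℂ) ^ k * g y = 0) : ∀ᵐ y, g y = 0 := by
  have h1 : ∀ (h : ℝ), |h| < δ → ∀ (m k : ℕ),
      ∫ y : ℝ, (y : ℂ) ^ k * (cexp (I * (m * h : ℝ) * y) * g y) = 0 := by
    intro h hh m
    induction m with
    | zero => simpa using hm
    | succ m ih =>
      intro k
      have := moments_exp_mul_eq_zero (g := fun y => cexp (I * (m * h : ℝ) * y) * g y)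
        ((by fun_prop : AEStronglyMeasurable (fun y : ℝ => cexp (I * (m * h : ℝ) * y))).mul hg)
        (by
          refine hint.congr (.of_forall fun y => ?_)
          simp only [norm_mul]
          rw [show I * ((m * h : ℝ) : ℂ) * y = ((m * h * y : ℝ) : ℂ) * I by push_cast; ring,
            Complex.norm_exp_ofReal_mul_I, one_mul]) hh ih k
      rw [← this]
      congr 1 with y
      rw [← mul_assoc (cexp _), ← Complex.exp_add]
      congr 3
      push_cast
      ring
  have h2 : ∀ ξ : ℝ, ∫ y : ℝ, cexp (I * ξ * y) * g y = 0 := by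
    intro ξ
    obtain ⟨m, hm⟩ := exists_nat_gt (|ξ| / δ)
    have hm0 : (0 : ℝ) < m := lt_of_le_of_lt (by positivity) hm
    have := h1 (ξ / m) (by
      rw [abs_div, Nat.abs_cast, div_lt_iff₀ hm0]
      rwa [div_lt_iff₀ hδ, mul_comm] at hm) m 0
    rw [mul_div_cancel₀ _ hm0.ne'] at this
    simpa using this
  have hgi : Integrable g := by
    refine hint.mono hg (.of_forall fun y => ?_)
    rw [norm_mul, norm_norm]
    refine le_mul_of_one_le_left (norm_nonneg _) ?_
    rw [Real.norm_eq_abs, Real.abs_exp]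
    exact Real.one_le_exp (by positivity)
  have h3 : 𝓕 g = 0 := by
    ext ξ
    rw [Real.fourier_real_eq_integral_exp_smul, Pi.zero_apply, ← h2 (-2 * Real.pi * ξ)]
    congr 1 with y
    rw [smul_eq_mul]
    congr 2
    push_cast
    ring
  refine ae_eq_zero_of_integral_contDiff_smul_eq_zero hgi.locallyIntegrable fun φ hφ hφc => ?_
  have hg₁ : HasCompactSupport (Complex.ofRealCLM ∘ φ) := hφc.comp_left rfl
  have hg₂ : ContDiff ℝ ∞ (Complex.ofRealCLM ∘ φ) := by fun_prop
  set f := hg₁.toSchwartzMap hg₂ with hf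
  have h4 := VectorFourier.integral_fourierIntegral_smul_eq_flip (L := innerₗ ℝ)
    Real.continuous_fourierChar continuous_inner (𝓕⁻ f).integrable hgi (μ := volume) (ν := volume)
  have h5 : ∀ y, VectorFourier.fourierIntegral Real.fourierChar volume (innerₗ ℝ)
      (𝓕⁻ f : SchwartzMap ℝ ℂ) y = φ y := by
    intro y
    have : (𝓕 (𝓕⁻ f) : SchwartzMap ℝ ℂ) y = f y := by simp
    rw [SchwartzMap.fourier_coe] at this
    exact this
  have h6 : ∀ y, VectorFourier.fourierIntegral Real.fourierChar volume (innerₗ ℝ).flip g y = 0 := by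
    intro y
    have := congrFun h3 y
    rw [flip_innerₗ]
    exact this
  simp only [h5, h6, smul_zero, integral_zero] at h4
  simpa using h4

theorem exists_norm_eval_le_exp (R : ℂ[X]) {δ : ℝ} (hδ : 0 < δ) :
    ∃ C : ℝ, 0 ≤ C ∧ ∀ x : ℂ, ‖R.eval x‖ ≤ C * Real.exp (δ * ‖x‖) := by
  induction R using Polynomial.induction_on' with
  | add p q hp hq =>
    obtain ⟨A, hA, h1⟩ := hp
    obtain ⟨B, hB, h2⟩ := hq
    refine ⟨A + B, add_nonneg hA hB, fun x => ?_⟩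
    rw [eval_add, add_mul]
    exact (norm_add_le _ _).trans (add_le_add (h1 x) (h2 x))
  | monomial n r =>
    refine ⟨‖r‖ * (n.factorial / δ ^ n), by positivity, fun x => ?_⟩
    rw [eval_monomial, norm_mul, norm_pow, mul_assoc]
    have := abs_pow_le_exp hδ n ‖x‖
    rw [abs_norm] at this
    gcongr

theorem integrable_exp_mul_of_le {f : ℝ → ℂ} {C δ δ' : ℝ} (hδ : δ' < δ)
    (hf : AEStronglyMeasurable f) (hC : ∀ y, ‖f y‖ ≤ C * Real.exp (-(δ * |y|))) :
    Integrable fun y : ℝ => Real.exp (δ' * |y|) * ‖f y‖ := by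
  refine ((integrable_exp_neg_mul_abs (sub_pos.2 hδ)).const_mul C).mono'
    ((by fun_prop : AEStronglyMeasurable (fun y : ℝ => Real.exp (δ' * |y|))).mul hf.norm)
    (.of_forall fun y => ?_)
  rw [Real.norm_of_nonneg (by positivity)]
  calc Real.exp (δ' * |y|) * ‖f y‖ ≤ Real.exp (δ' * |y|) * (C * Real.exp (-(δ * |y|))) := by
        gcongr; exact hC y
    _ = C * Real.exp (-((δ - δ') * |y|)) := by
        rw [show -((δ - δ') * |y|) = δ' * |y| + -(δ * |y|) by ring, Real.exp_add]; ring

theorem integrable_eval_mul_of_le {f : ℝ → ℂ} {C δ : ℝ} (hδ : 0 < δ)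
    (hf : AEStronglyMeasurable f) (hC : ∀ y, ‖f y‖ ≤ C * Real.exp (-(δ * |y|)))
    (R : ℂ[X]) : Integrable fun y : ℝ => R.eval (y : ℂ) * f y := by
  obtain ⟨A, hA, hR⟩ := exists_norm_eval_le_exp R (half_pos hδ)
  refine ((integrable_exp_mul_of_le (half_lt_self hδ) hf hC).const_mul A).mono'
    ((by fun_prop : AEStronglyMeasurable (fun y : ℝ => R.eval (y : ℂ))).mul hf)
    (.of_forall fun y => ?_)
  rw [norm_mul, ← mul_assoc]
  gcongr
  simpa using hR y

section Density

variable {μ : Measure ℝ} {δ : ℝ}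

theorem memLp_eval (hδ : 0 < δ) (hμ : Integrable (fun y : ℝ => Real.exp (δ * |y|)) μ) (R : ℂ[X]) :
    MemLp (fun y : ℝ => R.eval (y : ℂ)) 2 μ := by
  rw [memLp_two_iff_integrable_sq_norm (by fun_prop)]
  obtain ⟨A, hA, hR⟩ := exists_norm_eval_le_exp R (half_pos hδ)
  refine (hμ.const_mul (A ^ 2)).mono' (by fun_prop) (.of_forall fun y => ?_)
  rw [Real.norm_of_nonneg (by positivity)]
  calc ‖R.eval (y : ℂ)‖ ^ 2 ≤ (A * Real.exp (δ / 2 * ‖(y : ℂ)‖)) ^ 2 := by gcongr; exact hR y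
    _ = A ^ 2 * Real.exp (δ * |y|) := by
      rw [mul_pow, ← Real.exp_nat_mul, Complex.norm_real, Real.norm_eq_abs]
      congr 2
      push_cast
      ring

/-- Polynomials, as elements of `L²(μ)`. -/
def polyLp (hδ : 0 < δ) (hμ : Integrable (fun y : ℝ => Real.exp (δ * |y|)) μ) :
    ℂ[X] →ₗ[ℂ] Lp ℂ 2 μ where
  toFun R := (memLp_eval hδ hμ R).toLp
  map_add' R S := by
    rw [← MemLp.toLp_add]
    congr 1 with y
    simp
  map_smul' r R := by
    rw [RingHom.id_apply, ← MemLp.toLp_const_smul]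
    congr 1 with y
    simp

/-- Polynomials are dense in `L²(w dy)` for an exponentially decaying weight `w`. -/
theorem range_polyLp_topologicalClosure {w : ℝ → NNReal} (hw : Measurable w) (hδ : 0 < δ)
    (hμ : Integrable (fun y : ℝ => Real.exp (δ * |y|)) (volume.withDensity fun y => w y)) :
    (LinearMap.range (polyLp hδ hμ)).topologicalClosure = ⊤ := by
  rw [Submodule.topologicalClosure_eq_top_iff, Submodule.eq_bot_iff]
  intro f hf
  have hexp : MemLp (fun y : ℝ => Real.exp (δ / 2 * |y|)) 2 (volume.withDensity fun y => w y) := by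
    rw [memLp_two_iff_integrable_sq_norm (by fun_prop)]
    refine hμ.congr (.of_forall fun y => ?_)
    simp only [Real.norm_eq_abs, Real.abs_exp]
    rw [← Real.exp_nat_mul]
    congr 1
    push_cast
    ring
  have hfm : MemLp (fun y => ‖f y‖) 2 (volume.withDensity fun y => w y) := (Lp.memLp f).norm
  have h1 : Integrable (fun y : ℝ => Real.exp (δ / 2 * |y|) * ‖f y‖)
      (volume.withDensity fun y => w y) := hexp.integrable_mul hfm
  rw [integrable_withDensity_iff_integrable_smul hw] at h1
  have h2 : ∀ᵐ y, (w y : ℂ) * f y = 0 := by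
    refine ae_eq_zero_of_moments_eq_zero (half_pos hδ) ?_ (h1.congr (.of_forall fun y => ?_))
      fun k => ?_
    · exact (by fun_prop : AEStronglyMeasurable (fun y => ((w y : ℝ) : ℂ))).mul
        (Lp.stronglyMeasurable f).aestronglyMeasurable
    · simp [NNReal.smul_def]
      ring
    · have h3 := (Submodule.mem_orthogonal _ _).1 hf _ ⟨X ^ k, rfl⟩
      rw [L2.inner_def] at h3
      have h4 : ∫ y, (y : ℂ) ^ k * f y ∂(volume.withDensity fun y => w y) = 0 := by
        rw [← h3]
        refine integral_congr_ae ?_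
        filter_upwards [(memLp_eval hδ hμ (X ^ k)).coeFn_toLp] with y hy
        have hy' : (polyLp hδ hμ (X ^ k)) y = (y : ℂ) ^ k := Eq.trans hy (by simp)
        rw [hy', RCLike.inner_apply]
        simp [mul_comm]
      rw [integral_withDensity_eq_integral_smul hw] at h4
      rw [← h4]
      congr 1 with y
      rw [NNReal.smul_def, Complex.real_smul]
      ring
  rw [Lp.eq_zero_iff_ae_eq_zero, Filter.EventuallyEq,
    ae_withDensity_iff (by fun_prop)]
  filter_upwards [h2] with y hy hwy
  have : (w y : ℂ) ≠ 0 := by simpa using hwy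
  simpa [this] using hy

/-- An exponentially decaying continuous weight against which all squares of polynomials have
nonnegative integral is nonnegative: approximate the indicator of `{w < 0}` in `L²(|w| dy)`. -/
theorem nonneg_of_integral_normSq_mul_nonneg {w : ℝ → ℝ} (hw : Continuous w) {C : ℝ} (hδ : 0 < δ)
    (hC : ∀ y, |w y| ≤ C * Real.exp (-(δ * |y|)))
    (hpos : ∀ R : ℂ[X], 0 ≤ ∫ y : ℝ, ‖R.eval (y : ℂ)‖ ^ 2 * w y) (y : ℝ) : 0 ≤ w y := by
  have hwm : Measurable fun y => ‖w y‖₊ := by fun_prop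
  set ν := volume.withDensity fun y => (‖w y‖₊ : ENNReal) with hν
  have hμ : Integrable (fun y : ℝ => Real.exp (δ / 2 * |y|)) ν := by
    rw [hν, integrable_withDensity_iff_integrable_smul hwm]
    refine (integrable_exp_mul_of_le (f := fun y => (w y : ℂ)) (C := C) (half_lt_self hδ)
      (by fun_prop) fun y => ?_).congr (.of_forall fun y => ?_)
    · simpa using hC y
    · simp [NNReal.smul_def, mul_comm]
  have hfin : IsFiniteMeasure ν := by
    have : Integrable (fun _ => (1 : ℝ)) ν := by
      refine hμ.mono' (by fun_prop) (.of_forall fun y => ?_)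
      simpa using Real.one_le_exp (by positivity : 0 ≤ δ / 2 * |y|)
    simpa [integrable_const_iff] using this
  set N : Set ℝ := {y | w y < 0}
  have hN : MeasurableSet N := measurableSet_lt (by fun_prop) (by fun_prop)
  have hind : MemLp (N.indicator fun _ => (1 : ℂ)) 2 ν := (memLp_const 1).indicator hN
  have hcont : Continuous fun y => max (-w y) 0 := by fun_prop
  have hi3 : Integrable fun y => max (-w y) 0 := by
    have h1 := integrable_exp_mul_of_le (f := fun y => (w y : ℂ)) (δ' := 0) hδ (by fun_prop)
      (by simpa using hC)
    refine h1.mono' (by fun_prop) (.of_forall fun y => ?_)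
    simp [abs_of_nonneg, neg_le_abs]
  -- if `R` approximates the indicator `χ` of `{w < 0}`, then `w⁻ ≤ 2|χ - R|²|w| - 2|R|²w` pointwise
  have key : ∀ η > 0, ∫ y, max (-w y) 0 ≤ 2 * η ^ 2 := by
    intro η hη
    have hmem : hind.toLp ∈ (LinearMap.range (polyLp (half_pos hδ) hμ)).topologicalClosure := by
      rw [range_polyLp_topologicalClosure hwm]; trivial
    obtain ⟨_, ⟨R, rfl⟩, hR⟩ := Metric.mem_closure_iff.1 hmem η hη
    have hd := hind.sub (memLp_eval (half_pos hδ) hμ R)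
    set F : Lp ℂ 2 ν := hd.toLp _ with hF
    have hdist : ‖F‖ < η := by
      rw [hF, MemLp.toLp_sub hind (memLp_eval (half_pos hδ) hμ R), ← dist_eq_norm]; exact hR
    have hsq : ∫ y, ‖N.indicator (fun _ => (1 : ℂ)) y - R.eval (y : ℂ)‖ ^ 2 * |w y| ≤ η ^ 2 := by
      have h1 : ‖F‖ ^ 2
          = ∫ y, ‖N.indicator (fun _ => (1 : ℂ)) y - R.eval (y : ℂ)‖ ^ 2 ∂ν := by
        have h2 := inner_self_eq_norm_sq_to_K (𝕜 := ℂ) F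
        rw [L2.inner_def] at h2
        have h3 : ∫ y, inner ℂ (F y) (F y) ∂ν
            = ∫ y, ((‖N.indicator (fun _ => (1 : ℂ)) y - R.eval (y : ℂ)‖ ^ 2 : ℝ) : ℂ) ∂ν := by
          refine integral_congr_ae ?_
          filter_upwards [hd.coeFn_toLp] with y hy
          rw [hy, inner_self_eq_norm_sq_to_K]
          simp
        rw [h3, integral_complex_ofReal] at h2
        exact Complex.ofReal_injective ((Complex.ofReal_pow _ _).trans h2.symm)
      have h4 := integral_withDensity_eq_integral_smul (μ := volume) hwm
        fun y : ℝ => ‖N.indicator (fun _ => (1 : ℂ)) y - R.eval (y : ℂ)‖ ^ 2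
      calc _ = ‖F‖ ^ 2 := by
            rw [h1, hν, h4]
            congr 1 with y
            simp [NNReal.smul_def, mul_comm]
        _ ≤ _ := by gcongr
    have hi1 : Integrable fun y =>
        ‖N.indicator (fun _ => (1 : ℂ)) y - R.eval (y : ℂ)‖ ^ 2 * |w y| := by
      have h1 := (memLp_two_iff_integrable_sq_norm hd.1).1 hd
      rw [hν, integrable_withDensity_iff_integrable_smul hwm] at h1
      refine h1.congr (.of_forall fun y => ?_)
      simp [NNReal.smul_def, mul_comm]
    have hi2 : Integrable fun y : ℝ => ‖R.eval (y : ℂ)‖ ^ 2 * w y := by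
      have h1 := memLp_eval (half_pos hδ) hμ R
      have h1 := (memLp_two_iff_integrable_sq_norm h1.1).1 h1
      rw [hν, integrable_withDensity_iff_integrable_smul hwm] at h1
      refine h1.mono (by fun_prop) (.of_forall fun y => ?_)
      simp [NNReal.smul_def, mul_comm]
    calc ∫ y, max (-w y) 0 ≤ ∫ y, (2 * (‖N.indicator (fun _ => (1 : ℂ)) y - R.eval (y : ℂ)‖ ^ 2
          * |w y|) - 2 * (‖R.eval (y : ℂ)‖ ^ 2 * w y)) := by
          refine integral_mono hi3 ((hi1.const_mul 2).sub (hi2.const_mul 2)) fun y => ?_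
          by_cases hy : w y < 0
          · have hy' : y ∈ N := hy
            have h1 : (1 : ℝ) ≤ ‖1 - R.eval (y : ℂ)‖ + ‖R.eval (y : ℂ)‖ := by
              simpa using norm_add_le (1 - R.eval (y : ℂ)) (R.eval (y : ℂ))
            simp only [Set.indicator_of_mem hy', abs_of_neg hy]
            rw [max_eq_left (by linarith)]
            have h2 : 1 ≤ 2 * ‖1 - R.eval (y : ℂ)‖ ^ 2 + 2 * ‖R.eval (y : ℂ)‖ ^ 2 := by
              nlinarith [sq_nonneg (‖1 - R.eval (y : ℂ)‖ - ‖R.eval (y : ℂ)‖)]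
            nlinarith
          · have hy' : y ∉ N := hy
            simp only [Set.indicator_of_notMem hy', zero_sub, norm_neg]
            rw [abs_of_nonneg (not_lt.1 hy), max_eq_right (by linarith), sub_self]
      _ = 2 * (∫ y, ‖N.indicator (fun _ => (1 : ℂ)) y - R.eval (y : ℂ)‖ ^ 2 * |w y|)
          - 2 * ∫ y : ℝ, ‖R.eval (y : ℂ)‖ ^ 2 * w y := by
          rw [integral_sub (hi1.const_mul 2) (hi2.const_mul 2), integral_const_mul,
            integral_const_mul]
      _ ≤ 2 * η ^ 2 := by linarith [hpos R]
  by_contra hy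
  have hint : 0 < ∫ y, max (-w y) 0 :=
    integral_pos_of_integrable_nonneg_nonzero hcont hi3 (fun y => le_max_right _ _) (x := y)
      (lt_max_of_lt_left (by linarith)).ne'
  have := key (Real.sqrt ((∫ y, max (-w y) 0) / 4)) (by positivity)
  rw [Real.sq_sqrt (by positivity)] at this
  linarith

end Density

end Moments

/-! ### Shifting contours in a vertical strip -/

section Strip

open MeasureTheory Complex Filter Topology
open scoped Real ComplexOrder ComplexConjugate

/-- Exponential decay in the strip `|Re x| ≤ 1/2`. -/
def StripDecay (f : ℂ → ℂ) : Prop :=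
  ∃ C δ : ℝ, 0 < δ ∧ ∀ x : ℂ, |x.re| ≤ 1 / 2 → ‖f x‖ ≤ C * Real.exp (-(δ * |x.im|))

theorem StripDecay.exists_nonneg {f : ℂ → ℂ} (hf : StripDecay f) : ∃ C δ : ℝ, 0 ≤ C ∧ 0 < δ ∧
    ∀ x : ℂ, |x.re| ≤ 1 / 2 → ‖f x‖ ≤ C * Real.exp (-(δ * |x.im|)) := by
  obtain ⟨C, δ, hδ, h⟩ := hf
  refine ⟨C, δ, ?_, hδ, h⟩
  simpa using (norm_nonneg _).trans (h 0 (by simp))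

theorem StripDecay.zero : StripDecay fun _ => 0 := ⟨0, 1, one_pos, by simp⟩

theorem StripDecay.add {f g : ℂ → ℂ} (hf : StripDecay f) (hg : StripDecay g) :
    StripDecay fun x => f x + g x := by
  obtain ⟨C, δ, hC, hδ, h⟩ := hf.exists_nonneg
  obtain ⟨C', δ', hC', hδ', h'⟩ := hg.exists_nonneg
  refine ⟨C + C', min δ δ', lt_min hδ hδ', fun x hx => (norm_add_le _ _).trans ?_⟩
  rw [add_mul]
  refine add_le_add ((h x hx).trans ?_) ((h' x hx).trans ?_) <;> gcongr
  · exact min_le_left _ _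
  · exact min_le_right _ _

theorem StripDecay.const_mul {f : ℂ → ℂ} (hf : StripDecay f) (a : ℂ) :
    StripDecay fun x => a * f x := by
  obtain ⟨C, δ, hδ, h⟩ := hf
  refine ⟨‖a‖ * C, δ, hδ, fun x hx => ?_⟩
  rw [norm_mul, mul_assoc]
  gcongr
  exact h x hx

theorem StripDecay.mul {f g : ℂ → ℂ} (hf : StripDecay f) (hg : StripDecay g) :
    StripDecay fun x => f x * g x := by
  obtain ⟨C, δ, hC, hδ, h⟩ := hf.exists_nonneg
  obtain ⟨C', δ', hC', hδ', h'⟩ := hg.exists_nonneg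
  refine ⟨C * C', δ + δ', add_pos hδ hδ', fun x hx => ?_⟩
  rw [norm_mul, add_mul, neg_add, Real.exp_add, mul_mul_mul_comm]
  exact mul_le_mul (h x hx) (h' x hx) (norm_nonneg _) (by positivity)

theorem StripDecay.sum {ι : Type*} (s : Finset ι) {f : ι → ℂ → ℂ}
    (hf : ∀ i ∈ s, StripDecay (f i)) : StripDecay fun x => ∑ i ∈ s, f i x := by
  classical
  induction s using Finset.induction_on with
  | empty => simpa using StripDecay.zero
  | insert i s hi ih =>
    simp only [Finset.sum_insert hi]
    exact (hf i (by simp)).add (ih fun j hj => hf j (by simp [hj]))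

theorem StripDecay.multiset_prod {ι : Type*} {s : Multiset ι} (hs : s ≠ 0) {f : ι → ℂ → ℂ}
    (hf : ∀ i ∈ s, StripDecay (f i)) : StripDecay fun x => (s.map fun i => f i x).prod := by
  induction s using Multiset.induction_on with
  | empty => exact absurd rfl hs
  | cons i s ih =>
    simp only [Multiset.map_cons, Multiset.prod_cons]
    rcases eq_or_ne s 0 with rfl | h
    · simpa using hf i (by simp)
    · exact (hf i (by simp)).mul (ih h fun j hj => hf j (by simp [hj]))

theorem StripDecay.eval_mul {f : ℂ → ℂ} (hf : StripDecay f) (R : ℂ[X]) :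
    StripDecay fun x => R.eval x * f x := by
  obtain ⟨C, δ, hC, hδ, h⟩ := hf.exists_nonneg
  obtain ⟨A, hA, hR⟩ := exists_norm_eval_le_exp R (half_pos hδ)
  refine ⟨A * Real.exp (δ / 2 * (1 / 2)) * C, δ / 2, half_pos hδ, fun x hx => ?_⟩
  rw [norm_mul]
  calc ‖R.eval x‖ * ‖f x‖
      ≤ (A * Real.exp (δ / 2 * (1 / 2 + |x.im|))) * (C * Real.exp (-(δ * |x.im|))) := by
        refine mul_le_mul ((hR x).trans ?_) (h x hx) (norm_nonneg _) (by positivity)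
        gcongr
        exact (norm_le_abs_re_add_abs_im x).trans (by linarith)
    _ = A * Real.exp (δ / 2 * (1 / 2)) * C * Real.exp (-(δ / 2 * |x.im|)) := by
        rw [show -(δ / 2 * |x.im|) = δ / 2 * |x.im| + -(δ * |x.im|) by ring, mul_add,
          Real.exp_add, Real.exp_add]
        ring

theorem StripDecay.integrable {f : ℂ → ℂ} (hf : StripDecay f) {a : ℝ} (ha : |a| ≤ 1 / 2)
    (hc : Continuous fun y : ℝ => f (a + y * I)) : Integrable fun y : ℝ => f (a + y * I) := by
  obtain ⟨C, δ, hδ, h⟩ := hf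
  refine ((integrable_exp_neg_mul_abs hδ).const_mul C).mono' hc.aestronglyMeasurable
    (.of_forall fun y => ?_)
  simpa using h (a + y * I) (by simpa using ha)

/-- The closed vertical strip `|Re x| ≤ 1/2`. -/
def strip : Set ℂ := {x | |x.re| ≤ 1 / 2}

theorem continuous_vertical {f : ℂ → ℂ} (hf : ContinuousOn f strip) {a : ℝ} (ha : |a| ≤ 1 / 2) :
    Continuous fun y : ℝ => f (a + y * I) :=
  hf.comp_continuous (by fun_prop) fun y => by simpa [strip] using ha

/-- Cauchy's theorem: integrals over vertical lines in the strip agree. -/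
theorem integral_vertical_eq {f : ℂ → ℂ} (hf : StripDecay f) (hd : DifferentiableOn ℂ f strip)
    {a b : ℝ} (ha : |a| ≤ 1 / 2) (hb : |b| ≤ 1 / 2) :
    ∫ y : ℝ, f (a + y * I) = ∫ y : ℝ, f (b + y * I) := by
  have hia := hf.integrable ha (continuous_vertical hd.continuousOn ha)
  have hib := hf.integrable hb (continuous_vertical hd.continuousOn hb)
  have hab : Set.uIcc a b ⊆ {x | |x| ≤ 1 / 2} := fun x hx => by
    have : Set.uIcc a b ⊆ Set.Icc (-(1 / 2)) (1 / 2) :=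
      Set.uIcc_subset_Icc (abs_le.1 ha) (abs_le.1 hb)
    exact abs_le.2 (this hx)
  have hrect : ∀ T : ℝ, (∫ x in a..b, f (x + (-T : ℝ) * I)) - (∫ x in a..b, f (x + T * I)) +
      I • (∫ y in (-T)..T, f (b + y * I)) - I • (∫ y in (-T)..T, f (a + y * I)) = 0 := fun T => by
    have := integral_boundary_rect_eq_zero_of_differentiableOn f (a + (-T : ℝ) * I) (b + T * I)
      (hd.mono fun x hx => by
        have h1 : x.re ∈ Set.uIcc a b := by simpa using hx.1
        exact hab h1)
    simpa using this
  obtain ⟨C, δ, hδ, h⟩ := hf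
  have hhor : ∀ σ : ℝ → ℝ, (∀ T, |σ T| = |T|) →
      Tendsto (fun T : ℝ => ∫ x in a..b, f (x + σ T * I)) atTop (𝓝 0) := by
    intro σ hσ
    refine squeeze_zero_norm' (a := fun T => C * Real.exp (-(δ * T)) * |b - a|) ?_ ?_
    · filter_upwards [eventually_ge_atTop 0] with T hT
      refine intervalIntegral.norm_integral_le_of_norm_le_const fun x hx => ?_
      have := h (x + σ T * I) (by simpa using hab (Set.uIoc_subset_uIcc hx))
      simpa [hσ, abs_of_nonneg hT] using this
    · have h1 : Tendsto (fun T : ℝ => Real.exp (-(δ * T))) atTop (𝓝 0) :=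
        Real.tendsto_exp_neg_atTop_nhds_zero.comp (tendsto_id.const_mul_atTop hδ)
      simpa using (h1.const_mul C).mul_const |b - a|
  have h1 := hhor (fun T => -T) (by simp)
  have h2 := hhor (fun T => T) (by simp)
  have h3 := intervalIntegral_tendsto_integral hia tendsto_neg_atTop_atBot tendsto_id
  have h4 := intervalIntegral_tendsto_integral hib tendsto_neg_atTop_atBot tendsto_id
  have h5 := ((h1.sub h2).add (h4.const_smul I)).sub (h3.const_smul I)
  simp only [id] at h5
  rw [tendsto_congr hrect] at h5
  have h6 := tendsto_nhds_unique h5 tendsto_const_nhds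
  rw [sub_zero, zero_add, ← smul_sub, smul_eq_zero] at h6
  exact (sub_eq_zero.1 (h6.resolve_left I_ne_zero)).symm

/-! ### The entire function `(exp (2πis) - 1) / s` -/

/-- The entire function `(exp (2πis) - 1) / s`. -/
def expQuot : ℂ → ℂ := dslope (fun s => cexp (2 * π * I * s)) 0

theorem mul_expQuot (s : ℂ) : s * expQuot s = cexp (2 * π * I * s) - 1 := by
  have := sub_smul_dslope (fun s => cexp (2 * π * I * s)) 0 s
  simpa [expQuot] using this

theorem differentiable_expQuot : Differentiable ℂ expQuot := by
  rw [← differentiableOn_univ, expQuot, Complex.differentiableOn_dslope Filter.univ_mem]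
  exact Differentiable.differentiableOn (by fun_prop)

theorem expQuot_zero : expQuot 0 = 2 * π * I := by
  rw [expQuot, dslope_same]
  have : HasDerivAt (fun s : ℂ => cexp (2 * π * I * s))
      (cexp (2 * π * I * 0) * (2 * π * I * 1)) 0 :=
    ((hasDerivAt_id (0 : ℂ)).const_mul (2 * π * I)).cexp
  rw [this.deriv]
  simp

theorem expQuot_ne_zero {s : ℂ} (hs : |s.re| < 1) : expQuot s ≠ 0 := by
  intro h
  rcases eq_or_ne s 0 with rfl | h0
  · rw [expQuot_zero] at h
    simp [Real.pi_ne_zero] at h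
  · have h1 := mul_expQuot s
    rw [h, mul_zero, eq_comm, sub_eq_zero, Complex.exp_eq_one_iff] at h1
    obtain ⟨n, hn⟩ := h1
    have h2 : s = n := by
      have h3 : (2 * π * I : ℂ) ≠ 0 := by simp [Real.pi_ne_zero]
      rw [mul_comm (n : ℂ)] at hn
      exact mul_left_cancel₀ h3 hn
    rw [h2] at hs
    simp only [intCast_re] at hs
    have : |n| < 1 := by exact_mod_cast hs
    rw [Int.abs_lt_one_iff] at this
    exact h0 (by simp [h2, this])

theorem exp_neg_conj (s : ℂ) : cexp (2 * π * I * -conj s) = conj (cexp (2 * π * I * s)) := by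
  rw [← Complex.exp_conj]
  simp [map_ofNat]

theorem expQuot_neg_conj (s : ℂ) : expQuot (-conj s) = -conj (expQuot s) := by
  rcases eq_or_ne s 0 with rfl | h0
  · simp [expQuot_zero, map_ofNat]
  · have h1 : (-conj s) ≠ 0 := by simpa using h0
    refine mul_left_cancel₀ h1 ?_
    rw [mul_expQuot, exp_neg_conj, neg_mul_neg, ← map_mul, mul_expQuot]
    simp

/-- On the imaginary axis `expQuot` is a positive multiple of `i`. -/
theorem expQuot_mul_I_pos (σ : ℝ) : 0 < -I * expQuot (σ * I) := by
  rcases eq_or_ne σ 0 with rfl | h0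
  · have : -I * expQuot ((0 : ℝ) * I) = ((2 * π : ℝ) : ℂ) := by
      rw [ofReal_zero, zero_mul, expQuot_zero]
      push_cast
      linear_combination (-2 * π) * I_sq
    rw [this]
    exact_mod_cast Real.two_pi_pos
  · have h1 := mul_expQuot (σ * I)
    rw [show 2 * π * I * (σ * I) = ((-(2 * π * σ) : ℝ) : ℂ) by
      push_cast; linear_combination (2 * π * σ : ℂ) * I_sq, ← ofReal_exp] at h1
    have h2 : -I * expQuot (σ * I) = (((1 - Real.exp (-(2 * π * σ))) / σ : ℝ) : ℂ) := by
      have h3 : (σ : ℂ) ≠ 0 := by exact_mod_cast h0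
      rw [ofReal_div, eq_div_iff h3]
      push_cast at h1 ⊢
      linear_combination -h1
    rw [h2]
    have h4 : 0 < (1 - Real.exp (-(2 * π * σ))) / σ := by
      rcases lt_or_gt_of_ne h0 with h | h
      · refine div_pos_of_neg_of_neg ?_ h
        have : 0 < -(2 * π * σ) := by nlinarith [Real.pi_pos]
        linarith [Real.one_lt_exp_iff.2 this]
      · refine div_pos ?_ h
        have : -(2 * π * σ) < 0 := by nlinarith [Real.pi_pos]
        linarith [Real.exp_lt_one_iff.2 this]
    exact_mod_cast h4

/-- Exponential decay of `exp (2πiθs) s / (exp (2πis) - 1)`, `0 < θ < 1`, in vertical strips that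
avoid the poles `s = ±1, ±2, …`. -/
theorem exists_norm_exp_div_expQuot_le {θ r : ℝ} (h0 : 0 < θ) (h1 : θ < 1) (hr : r < 1) :
    ∃ C δ : ℝ, 0 ≤ C ∧ 0 < δ ∧ ∀ s : ℂ, |s.re| ≤ r →
      ‖cexp (2 * π * I * (θ * s)) / expQuot s‖ ≤ C * Real.exp (-(δ * |s.im|)) := by
  -- the quotient of exponentials decays at the rate `2δ`; half of it absorbs the factor `s`
  set δ := π * min θ (1 - θ) with hδdef
  have hm : 0 < min θ (1 - θ) := lt_min h0 (by linarith)
  have hδ : 0 < δ := mul_pos Real.pi_pos hm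
  have hK : IsCompact (Set.Icc (-r) r ×ℂ Set.Icc (-1) 1) := isCompact_Icc.reProdIm isCompact_Icc
  obtain ⟨A, hA⟩ := hK.exists_bound_of_continuousOn
    (f := fun s => cexp (2 * π * I * (θ * s)) / expQuot s) (by
      refine ContinuousOn.div (by fun_prop) differentiable_expQuot.continuous.continuousOn
        fun s hs => expQuot_ne_zero (lt_of_le_of_lt (abs_le.2 hs.1) hr))
  refine ⟨max (|A| * Real.exp δ) (2 * (1 + 1 / δ)), δ, le_max_of_le_left (by positivity), hδ,
    fun s hs => ?_⟩
  by_cases hb : |s.im| ≤ 1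
  · calc _ ≤ |A| * 1 := by
          rw [mul_one]; exact (hA s ⟨abs_le.1 hs, abs_le.1 hb⟩).trans (le_abs_self A)
      _ ≤ |A| * (Real.exp δ * Real.exp (-(δ * |s.im|))) := by
          gcongr
          rw [← Real.exp_add]
          exact Real.one_le_exp (by nlinarith)
      _ ≤ _ := by
          rw [← mul_assoc]
          gcongr
          exact le_max_left _ _
  · rw [not_le] at hb
    have hs0 : s ≠ 0 := by rintro rfl; simp at hb; linarith
    have hsn : ‖s‖ ≤ (1 + 1 / δ) * Real.exp (δ * |s.im|) := by
      have h2 := Real.add_one_le_exp (δ * |s.im|)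
      have h3 : 1 ≤ Real.exp (δ * |s.im|) := Real.one_le_exp (by positivity)
      have h4 : |s.im| ≤ 1 / δ * Real.exp (δ * |s.im|) := by
        rw [div_mul_eq_mul_div, one_mul, le_div_iff₀ hδ]; linarith
      have h5 := norm_le_abs_re_add_abs_im s
      linarith
    have hE : ‖expQuot s‖ = ‖cexp (2 * π * I * s) - 1‖ / ‖s‖ := by
      rw [← mul_expQuot, norm_mul, mul_div_cancel_left₀ _ (norm_ne_zero_iff.2 hs0)]
    have hn : ∀ a : ℝ, ‖cexp (2 * π * I * (a * s))‖ = Real.exp (-(2 * π * a * s.im)) := fun a => by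
      rw [Complex.norm_exp]
      congr 1
      simp
      ring
    have hn1 : ‖cexp (2 * π * I * s)‖ = Real.exp (-(2 * π * s.im)) := by
      simpa using hn 1
    have hkey : ‖cexp (2 * π * I * (θ * s))‖ ≤
        2 * Real.exp (-(2 * δ * |s.im|)) * ‖cexp (2 * π * I * s) - 1‖ := by
      have hbig : ∀ x : ℝ, 1 < x → 2 ≤ Real.exp (2 * π * x) := fun x hx => by
        have := Real.add_one_le_exp (2 * π * x)
        nlinarith [Real.pi_gt_three]
      rw [hn]
      rcases le_total 0 s.im with hi | hi
      · rw [abs_of_nonneg hi] at hb ⊢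
        have h2 : 1 / 2 ≤ ‖cexp (2 * π * I * s) - 1‖ := by
          have h3 := norm_sub_norm_le (1 : ℂ) (cexp (2 * π * I * s))
          rw [norm_one, hn1, norm_sub_rev, Real.exp_neg] at h3
          have h4 : (Real.exp (2 * π * s.im))⁻¹ ≤ 2⁻¹ := inv_anti₀ two_pos (hbig _ hb)
          linarith
        calc Real.exp (-(2 * π * θ * s.im)) ≤ Real.exp (-(2 * δ * s.im)) := by
              rw [Real.exp_le_exp, hδdef]
              nlinarith [mul_le_mul_of_nonneg_left (min_le_left θ (1 - θ)) Real.pi_pos.le]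
          _ = 2 * Real.exp (-(2 * δ * s.im)) * (1 / 2) := by ring
          _ ≤ _ := by gcongr
      · rw [abs_of_nonpos hi] at hb ⊢
        have h2 : Real.exp (-(2 * π * s.im)) / 2 ≤ ‖cexp (2 * π * I * s) - 1‖ := by
          have h3 := norm_sub_norm_le (cexp (2 * π * I * s)) 1
          rw [norm_one, hn1] at h3
          have h4 := hbig _ hb
          rw [mul_neg] at h4
          linarith
        calc Real.exp (-(2 * π * θ * s.im))
            ≤ Real.exp (-(2 * δ * -s.im) + -(2 * π * s.im)) := by
              rw [Real.exp_le_exp, hδdef]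
              nlinarith [mul_le_mul_of_nonneg_left (min_le_right θ (1 - θ)) Real.pi_pos.le]
          _ = 2 * Real.exp (-(2 * δ * -s.im)) * (Real.exp (-(2 * π * s.im)) / 2) := by
              rw [Real.exp_add]; ring
          _ ≤ _ := by gcongr
    rcases eq_or_ne (‖cexp (2 * π * I * s) - 1‖) 0 with hz | hz
    · rw [norm_div, hE, hz]
      simp
      positivity
    rw [norm_div, hE, div_div_eq_mul_div, div_le_iff₀ (lt_of_le_of_ne (norm_nonneg _) hz.symm)]
    calc _ ≤ (2 * Real.exp (-(2 * δ * |s.im|)) * ‖cexp (2 * π * I * s) - 1‖) *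
          ((1 + 1 / δ) * Real.exp (δ * |s.im|)) := by gcongr
      _ = (2 * (1 + 1 / δ)) * Real.exp (-(δ * |s.im|)) * ‖cexp (2 * π * I * s) - 1‖ := by
          rw [show -(δ * |s.im|) = -(2 * δ * |s.im|) + δ * |s.im| by ring, Real.exp_add]
          ring
      _ ≤ _ := by
          gcongr
          exact le_max_right _ _

end Strip

/-! ### The weight function and its shift -/

section Weight

open MeasureTheory Complex Filter Topology
open scoped Real ComplexOrder ComplexConjugate

/-- A product over a multiset stable under `α ↦ -conj α`, whose factors are conjugated by this
involution and positive at its fixed points, is positive. -/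
theorem multiset_prod_pos {s : Multiset ℂ} (hs : s.map (fun α => -conj α) = s) {f : ℂ → ℂ}
    (hconj : ∀ α ∈ s, f (-conj α) = conj (f α)) (hne : ∀ α ∈ s, f α ≠ 0)
    (hpos : ∀ α ∈ s, α.re = 0 → 0 < f α) : 0 < (s.map f).prod := by
  classical
  have hneg : s.filter (fun α => α.re < 0) =
      (s.filter fun α => 0 < α.re).map fun α => -conj α := by
    conv_lhs => rw [← hs]
    rw [Multiset.filter_map]
    congr 1
    refine Multiset.filter_congr fun α _ => ?_
    simp
  have h1 : s = s.filter (fun α => α.re = 0) +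
      (s.filter (fun α => 0 < α.re) + s.filter fun α => α.re < 0) := by
    ext α
    simp only [Multiset.count_add, Multiset.count_filter]
    rcases lt_trichotomy α.re 0 with h | h | h
    · simp [h, h.ne, h.not_gt]
    · simp [h]
    · simp [h, h.ne', h.not_gt]
  have hmul : ∀ t : Multiset ℂ, (∀ x ∈ t, 0 < x) → 0 < t.prod := fun t ht =>
    Multiset.prod_induction (fun x => 0 < x) t (fun _ _ => mul_pos) one_pos ht
  rw [h1, hneg, Multiset.map_add, Multiset.map_add, Multiset.prod_add, Multiset.prod_add,
    Multiset.map_map, ← Multiset.prod_map_mul]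
  refine mul_pos (hmul _ fun x hx => ?_) (hmul _ fun x hx => ?_)
  · obtain ⟨α, hα, rfl⟩ := Multiset.mem_map.1 hx
    rw [Multiset.mem_filter] at hα
    exact hpos α hα.1 hα.2
  · obtain ⟨α, hα, rfl⟩ := Multiset.mem_map.1 hx
    rw [Multiset.mem_filter] at hα
    rw [Function.comp_apply, hconj α hα.1, Complex.mul_conj]
    exact_mod_cast Complex.normSq_pos.2 (hne α hα.1)

/-- The holomorphic function `(x - α) / (e^{2πiα} - e^{2πix})`, where the removable singularity at
`x = α` is filled in by means of `expQuot`. -/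
def rootFactor (α x : ℂ) : ℂ := -cexp (-(2 * π * I * α)) / expQuot (x - α)

theorem rootFactor_mul {α x : ℂ} (h : |(x - α).re| < 1) :
    rootFactor α x * (cexp (2 * π * I * α) - cexp (2 * π * I * x)) = x - α := by
  have h1 := mul_expQuot (x - α)
  have h2 : cexp (2 * π * I * x) = cexp (2 * π * I * (x - α)) * cexp (2 * π * I * α) := by
    rw [← Complex.exp_add]; congr 1; ring
  have h3 : cexp (-(2 * π * I * α)) * cexp (2 * π * I * α) = 1 := by
    rw [← Complex.exp_add]; simp
  rw [rootFactor, div_mul_eq_mul_div, div_eq_iff (expQuot_ne_zero h), h2, h1]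
  linear_combination (cexp (2 * π * I * (x - α)) - 1) * h3

theorem rootFactor_ne_zero {α x : ℂ} (h : |(x - α).re| < 1) : rootFactor α x ≠ 0 :=
  div_ne_zero (neg_ne_zero.2 (Complex.exp_ne_zero _)) (expQuot_ne_zero h)

theorem differentiableAt_rootFactor {α x : ℂ} (h : |(x - α).re| < 1) :
    DifferentiableAt ℂ (rootFactor α) x := by
  refine DifferentiableAt.div (by fun_prop) ?_ (expQuot_ne_zero h)
  exact differentiable_expQuot.differentiableAt.comp x (by fun_prop)

theorem rootFactor_neg_conj (α : ℂ) (y : ℝ) :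
    -I * rootFactor (-conj α) (y * I) = conj (-I * rootFactor α (y * I)) := by
  have h1 : (y * I - -conj α : ℂ) = -conj (y * I - α) := by simp [add_comm]
  have h2 : cexp (-(2 * π * I * -conj α)) = conj (cexp (-(2 * π * I * α))) := by
    rw [← Complex.exp_conj]
    simp [map_ofNat]
  rw [rootFactor, rootFactor, h1, h2, expQuot_neg_conj]
  simp [div_neg]

/-- For `α` on the imaginary axis, `rootFactor α` is a positive multiple of `i` there. -/
theorem rootFactor_pos {α : ℂ} (hα : α.re = 0) (y : ℝ) : 0 < -I * rootFactor α (y * I) := by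
  have h1 : α = (α.im : ℂ) * I := by
    apply Complex.ext <;> simp [hα]
  have h2 : (y * I - α : ℂ) = ((y - α.im : ℝ) : ℂ) * I := by
    conv_lhs => rw [h1]
    push_cast; ring
  have h3 : -(2 * π * I * α) = ((2 * π * α.im : ℝ) : ℂ) := by
    conv_lhs => rw [h1]
    push_cast
    linear_combination (-2 * π * α.im : ℂ) * I_sq
  have h4 := expQuot_mul_I_pos (y - α.im)
  have h5 : -I * rootFactor α (y * I) = (Real.exp (2 * π * α.im) : ℂ) *
      (-I * expQuot ((y - α.im : ℝ) * I))⁻¹ := by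
    rw [rootFactor, h2, h3, ← ofReal_exp, mul_inv, inv_neg, inv_I, neg_neg]
    ring
  rw [h5]
  refine mul_pos ?_ (inv_pos.2 h4)
  exact_mod_cast Real.exp_pos _

variable {P : ℂ[X]}

/-- The product `P(x) / 𝐏(-e^{2πix})` in a form without singularities in the strip. -/
def rootProd (P : ℂ[X]) (x : ℂ) : ℂ := (P.roots.map fun α => rootFactor α x).prod

theorem eval_boldP (P : ℂ[X]) (x : ℂ) :
    (boldP P).eval x = (P.roots.map fun α => x + cexp (2 * π * I * α)).prod := by
  rw [boldP, eval_multiset_prod, Multiset.map_map]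
  simp

theorem abs_re_sub_lt {α x : ℂ} (hα : |α.re| < 1 / 2) (hx : |x.re| ≤ 1 / 2) :
    |(x - α).re| < 1 := by
  rw [sub_re]
  linarith [abs_sub x.re α.re]

theorem eval_eq_prod_sub_roots (hP : P.Monic) (x : ℂ) :
    P.eval x = (P.roots.map fun α => x - α).prod := by
  have h := (IsAlgClosed.splits P).eq_prod_roots_of_monic hP
  conv_lhs => rw [h, eval_multiset_prod, Multiset.map_map]
  simp

/-- In the strip, `rootProd P` is the quotient of `P(x)` by `𝐏(-e^{2πix})`. -/
theorem rootProd_mul_boldP (hP : P.Monic) (hr : ∀ α ∈ P.roots, |α.re| < 1 / 2) {x : ℂ}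
    (hx : |x.re| ≤ 1 / 2) : rootProd P x * (boldP P).eval (-cexp (2 * π * I * x)) = P.eval x := by
  rw [rootProd, eval_boldP, ← Multiset.prod_map_mul, eval_eq_prod_sub_roots hP]
  congr 1
  refine Multiset.map_congr rfl fun α hα => ?_
  rw [neg_add_eq_sub, rootFactor_mul (abs_re_sub_lt (hr α hα) hx)]

theorem exp_mul_I_eq (y : ℝ) :
    cexp (2 * π * I * (y * I)) = (Real.exp (-(2 * π * y)) : ℂ) := by
  rw [ofReal_exp]
  congr 1
  push_cast
  linear_combination (2 * π * y : ℂ) * I_sq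

theorem exp_mul_mul_I_eq (c y : ℝ) :
    cexp (2 * π * I * c * (y * I)) = (Real.exp (-(2 * π * c * y)) : ℂ) := by
  rw [ofReal_exp]
  congr 1
  push_cast
  linear_combination (2 * π * c * y : ℂ) * I_sq

/-- `𝐏` is positive on the positive half-line: its roots `-e^{2πiα}` avoid it because
`|Re α| < 1/2`, and those for `α` and `-conj α` are complex conjugates. -/
theorem boldP_pos (hroots : P.roots.map (fun α => -conj α) = P.roots)
    (hr : ∀ α ∈ P.roots, |α.re| < 1 / 2) {X : ℝ} (hX : 0 < X) : 0 < (boldP P).eval (X : ℂ) := by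
  rw [eval_boldP]
  refine multiset_prod_pos hroots (fun α _ => ?_) (fun α hα h => ?_) fun α _ h0 => ?_
  · rw [exp_neg_conj, map_add, conj_ofReal]
  · have h1 := hr α hα
    have h2 : cexp (2 * π * I * α) = -(X : ℂ) := by linear_combination h
    have hre := congrArg re h2
    have him := congrArg im h2
    rw [Complex.exp_re] at hre
    rw [Complex.exp_im] at him
    have h3 : (2 * π * I * α).im = 2 * π * α.re := by simp
    rw [h3] at hre him
    have h4 : Real.sin (2 * π * α.re) = 0 := by
      have := (mul_eq_zero.1 (him.trans (by simp))).resolve_left (Real.exp_pos _).ne'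
      exact this
    have h5 := (abs_lt.1 h1)
    rw [Real.sin_eq_zero_iff_of_lt_of_lt (by nlinarith [Real.pi_pos])
      (by nlinarith [Real.pi_pos])] at h4
    rw [h4, Real.cos_zero] at hre
    have := Real.exp_pos (2 * π * I * α).re
    simp only [neg_re, ofReal_re, mul_one] at hre
    linarith
  · have h1 : α = (α.im : ℂ) * I := by apply Complex.ext <;> simp [h0]
    rw [h1, exp_mul_I_eq]
    exact_mod_cast add_pos hX (Real.exp_pos _)

/-- The phase of `rootProd` on the imaginary axis is `iⁿ`, again by pairing `α` with `-conj α`. -/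
theorem rootProd_pos (hroots : P.roots.map (fun α => -conj α) = P.roots)
    (hr : ∀ α ∈ P.roots, |α.re| < 1 / 2) (y : ℝ) :
    0 < (-I) ^ P.roots.card * rootProd P (y * I) := by
  have h : (-I) ^ P.roots.card * rootProd P (y * I) =
      (P.roots.map fun α => -I * rootFactor α (y * I)).prod := by
    rw [Multiset.prod_map_mul, Multiset.map_const', Multiset.prod_replicate, rootProd]
  rw [h]
  refine multiset_prod_pos hroots (fun α _ => rootFactor_neg_conj α y) (fun α hα => ?_)
    fun α _ h0 => rootFactor_pos h0 y
  exact mul_ne_zero (neg_ne_zero.2 I_ne_zero)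
    (rootFactor_ne_zero (abs_re_sub_lt (hr α hα) (by simp)))

/-- The weight function attached to a complex polynomial `G`. -/
def cweight (P : ℂ[X]) (c : ℝ) (G : ℂ[X]) (x : ℂ) : ℂ :=
  cexp (2 * π * I * c * x) * G.eval (cexp (2 * π * I * x))
    / (boldP P).eval (cexp (2 * π * I * x))

theorem weight_eq_cweight (P : ℂ[X]) (c : ℝ) (G : ℝ[X]) (x : ℂ) :
    weight P c G x = cweight P c (G.map (algebraMap ℝ ℂ)) x := by
  rw [weight, cweight, eval_map_algebraMap]

/-- The function `P(x) w(x + 1/2)`, holomorphic in the strip, where `w` is the weight function. -/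
def shiftedWeight (P : ℂ[X]) (c : ℝ) (G : ℂ[X]) (x : ℂ) : ℂ :=
  cexp (2 * π * I * c * (x + 1 / 2)) * G.eval (-cexp (2 * π * I * x)) * rootProd P x

theorem exp_sub_half (x : ℂ) : cexp (2 * π * I * (x - 1 / 2)) = -cexp (2 * π * I * x) := by
  rw [mul_sub, Complex.exp_sub, show (2 * π * I * (1 / 2) : ℂ) = π * I by ring, exp_pi_mul_I]
  rw [div_neg, div_one]

theorem exp_add_half (x : ℂ) : cexp (2 * π * I * (x + 1 / 2)) = -cexp (2 * π * I * x) := by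
  rw [mul_add, Complex.exp_add, show (2 * π * I * (1 / 2) : ℂ) = π * I by ring, exp_pi_mul_I]
  simp

section

variable (hP : P.Monic) (hr : ∀ α ∈ P.roots, |α.re| < 1 / 2)
  (hroots : P.roots.map (fun α => -conj α) = P.roots)
include hP hr hroots

/-- On the left edge of the strip, `shiftedWeight` is `P` times the weight. -/
theorem shiftedWeight_sub_half (c : ℝ) (G : ℂ[X]) (y : ℝ) :
    shiftedWeight P c G (y * I - 1 / 2) = P.eval (y * I - 1 / 2) * cweight P c G (y * I) := by
  have h1 := rootProd_mul_boldP hP hr (x := y * I - 1 / 2) (by simp [abs_of_pos])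
  have h2 := boldP_pos hroots hr (Real.exp_pos (-(2 * π * y)))
  rw [exp_sub_half, neg_neg] at h1
  rw [← exp_mul_I_eq] at h2
  rw [shiftedWeight, cweight, exp_sub_half, neg_neg, sub_add_cancel, ← h1]
  have hB := h2.ne'
  generalize (boldP P).eval _ = B at hB ⊢
  field_simp

/-- On the right edge of the strip the factor `t` appears, since `w(x + 1) = t w(x)`. -/
theorem shiftedWeight_add_half (c : ℝ) (G : ℂ[X]) (y : ℝ) :
    shiftedWeight P c G (y * I + 1 / 2) =
      tOf c * (P.eval (y * I + 1 / 2) * cweight P c G (y * I)) := by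
  have h1 := rootProd_mul_boldP hP hr (x := y * I + 1 / 2) (by simp [abs_of_pos])
  have h2 := boldP_pos hroots hr (Real.exp_pos (-(2 * π * y)))
  rw [exp_add_half, neg_neg] at h1
  rw [← exp_mul_I_eq] at h2
  have h3 : cexp (2 * π * I * c * (y * I + 1 / 2 + 1 / 2)) =
      cexp (2 * π * I * c) * cexp (2 * π * I * c * (y * I)) := by
    rw [← Complex.exp_add]; congr 1; ring
  rw [shiftedWeight, cweight, exp_add_half, neg_neg, ← h1, h3, tOf, Units.val_mk0]
  have hB := h2.ne'
  generalize (boldP P).eval _ = B at hB ⊢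
  field_simp

end

theorem differentiableOn_shiftedWeight (hr : ∀ α ∈ P.roots, |α.re| < 1 / 2) (c : ℝ) (G : ℂ[X]) :
    DifferentiableOn ℂ (shiftedWeight P c G) strip := by
  have h : ∀ s : Multiset ℂ, (∀ α ∈ s, |α.re| < 1 / 2) →
      DifferentiableOn ℂ (fun x => (s.map fun α => rootFactor α x).prod) strip := by
    intro s hs
    induction s using Multiset.induction_on with
    | empty => simp
    | cons α s ih =>
      simp only [Multiset.map_cons, Multiset.prod_cons]
      refine DifferentiableOn.mul (fun x hx => ?_) (ih fun β hβ => hs β (by simp [hβ]))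
      exact (differentiableAt_rootFactor
        (abs_re_sub_lt (hs α (by simp)) hx)).differentiableWithinAt
  refine DifferentiableOn.mul (DifferentiableOn.mul (by fun_prop) ?_) (h _ hr)
  exact (G.differentiable.comp (by fun_prop : Differentiable ℂ fun x : ℂ =>
    -cexp (2 * π * I * x))).differentiableOn

theorem stripDecay_exp_mul_rootFactor {α : ℂ} (hα : |α.re| < 1 / 2) {θ : ℝ} (h0 : 0 < θ)
    (h1 : θ < 1) : StripDecay fun x => cexp (2 * π * I * (θ * x)) * rootFactor α x := by
  obtain ⟨C, δ, hC, hδ, h⟩ := exists_norm_exp_div_expQuot_le h0 h1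
    (r := 1 / 2 + |α.re|) (by linarith)
  refine ⟨‖cexp (2 * π * I * (θ * α)) * cexp (-(2 * π * I * α))‖ * (C * Real.exp (δ * |α.im|)),
    δ, hδ, fun x hx => ?_⟩
  have h2 : cexp (2 * π * I * (θ * x)) * rootFactor α x =
      -((cexp (2 * π * I * (θ * α)) * cexp (-(2 * π * I * α))) *
        (cexp (2 * π * I * (θ * (x - α))) / expQuot (x - α))) := by
    have h3 : cexp (2 * π * I * (θ * x)) =
        cexp (2 * π * I * (θ * α)) * cexp (2 * π * I * (θ * (x - α))) := by
      rw [← Complex.exp_add]; congr 1; ring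
    rw [rootFactor, h3]
    ring
  beta_reduce
  rw [h2, norm_neg, norm_mul]
  refine (mul_le_mul_of_nonneg_left ?_ (norm_nonneg _)).trans_eq (mul_assoc _ _ _).symm
  refine (h (x - α) ?_).trans ?_
  · rw [sub_re]
    linarith [abs_sub x.re α.re]
  · rw [mul_assoc, ← Real.exp_add]
    gcongr
    have : |x.im| ≤ |(x - α).im| + |α.im| := by
      rw [sub_im]
      simpa using abs_add_le (x.im - α.im) α.im
    nlinarith

/-- Distribute the factor `e^{2πiκx}` evenly over the `n` root factors, each receiving
`e^{2πiθx}` with `θ = κ / n ∈ (0, 1)`. -/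
theorem stripDecay_exp_mul_rootProd (hr : ∀ α ∈ P.roots, |α.re| < 1 / 2) {κ : ℝ} (h0 : 0 < κ)
    (h1 : κ < P.roots.card) : StripDecay fun x => cexp (2 * π * I * (κ * x)) * rootProd P x := by
  set n := P.roots.card with hn
  have hn0 : (0 : ℝ) < n := h0.trans h1
  have h2 : (fun x => cexp (2 * π * I * (κ * x)) * rootProd P x) = fun x =>
      (P.roots.map fun α => cexp (2 * π * I * ((κ / n : ℝ) * x)) * rootFactor α x).prod := by
    ext x
    rw [Multiset.prod_map_mul, Multiset.map_const', Multiset.prod_replicate, rootProd, ← hn,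
      ← Complex.exp_nat_mul]
    congr 2
    have : (n : ℂ) ≠ 0 := by exact_mod_cast hn0.ne'
    push_cast
    field_simp
  rw [h2]
  refine StripDecay.multiset_prod ?_ fun α hα => stripDecay_exp_mul_rootFactor (hr α hα)
    (div_pos h0 hn0) ((div_lt_one hn0).2 h1)
  rintro h
  rw [h] at hn
  simp [hn] at hn0

/-- Conditions on `G` under which the weight function decays exponentially on both ends. -/
def IsAdmissible (n : ℕ) (c : ℝ) (G : ℂ[X]) : Prop := G.degree < n ∧ (c = 0 → G.eval 0 = 0)

/-- The monomials `Xᵏ` of `G` contribute exponents `κ = c + k` with `0 < κ < n`; the value `κ = 0`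
can occur only for `c = 0` and is excluded by `G(0) = 0`. -/
theorem stripDecay_shiftedWeight (hr : ∀ α ∈ P.roots, |α.re| < 1 / 2) {c : ℝ} (hc0 : 0 ≤ c)
    (hc1 : c < 1) {G : ℂ[X]} (hG : IsAdmissible P.roots.card c G) :
    StripDecay (shiftedWeight P c G) := by
  have h1 : shiftedWeight P c G = fun x => ∑ k ∈ Finset.range P.roots.card,
      (G.coeff k * (-1) ^ k * cexp (π * I * c)) *
        (cexp (2 * π * I * (((c + k : ℝ) : ℂ) * x)) * rootProd P x) := by
    ext x
    by_cases hG0 : G = 0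
    · simp [shiftedWeight, hG0]
    rw [shiftedWeight, eval_eq_sum_range' ((natDegree_lt_iff_degree_lt hG0).2 hG.1),
      Finset.mul_sum, Finset.sum_mul]
    refine Finset.sum_congr rfl fun k _ => ?_
    have h2 : cexp (2 * π * I * c * (x + 1 / 2)) =
        cexp (2 * π * I * (c * x)) * cexp (π * I * c) := by
      rw [← Complex.exp_add]; congr 1; ring
    have h3 : cexp (2 * π * I * (((c + k : ℝ) : ℂ) * x)) =
        cexp (2 * π * I * (c * x)) * cexp (2 * π * I * x) ^ k := by
      rw [← Complex.exp_nat_mul, ← Complex.exp_add]; congr 1; push_cast; ring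
    rw [h2, h3, neg_pow]
    ring
  rw [h1]
  refine StripDecay.sum _ fun k hk => ?_
  rcases eq_or_lt_of_le (add_nonneg hc0 (Nat.cast_nonneg k : (0 : ℝ) ≤ k)) with h | h
  · have hk0 : (k : ℝ) = 0 := by linarith [(Nat.cast_nonneg k : (0 : ℝ) ≤ k)]
    have hc : c = 0 := by linarith
    have hk0 : k = 0 := by exact_mod_cast hk0
    have : G.coeff k = 0 := by rw [hk0, coeff_zero_eq_eval_zero, hG.2 hc]
    simpa [this] using StripDecay.zero
  · refine (stripDecay_exp_mul_rootProd hr h ?_).const_mul _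
    have hk' : (k : ℝ) + 1 ≤ P.roots.card := by exact_mod_cast Finset.mem_range.1 hk
    linarith

theorem exists_le_norm_prod_sub {s : Multiset ℂ} (hs : ∀ α ∈ s, |α.re| < 1 / 2) :
    ∃ b : ℝ, 0 < b ∧ ∀ x : ℂ, x.re = -(1 / 2) → b ≤ ‖(s.map fun α => x - α).prod‖ := by
  induction s using Multiset.induction_on with
  | empty => exact ⟨1, one_pos, by simp⟩
  | cons α s ih =>
    obtain ⟨b, hb, h⟩ := ih fun β hβ => hs β (by simp [hβ])
    have hα := hs α (by simp)
    refine ⟨(1 / 2 - |α.re|) * b, mul_pos (by linarith) hb, fun x hx => ?_⟩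
    rw [Multiset.map_cons, Multiset.prod_cons, norm_mul]
    refine mul_le_mul ?_ (h x hx) hb.le (norm_nonneg _)
    refine le_trans ?_ (abs_re_le_norm _)
    rw [sub_re, hx, abs_sub_comm]
    have := le_abs_self (α.re - -(1 / 2))
    linarith [neg_abs_le α.re]

section

variable (hP : P.Monic) (hr : ∀ α ∈ P.roots, |α.re| < 1 / 2)
  (hroots : P.roots.map (fun α => -conj α) = P.roots)
  {c : ℝ} (hc0 : 0 ≤ c) (hc1 : c < 1) {G : ℂ[X]} (hG : IsAdmissible P.roots.card c G)
include hr hroots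

theorem continuous_cweight (c : ℝ) (G : ℂ[X]) : Continuous fun y : ℝ => cweight P c G (y * I) := by
  refine Continuous.div (by fun_prop) (by fun_prop) fun y => ?_
  rw [exp_mul_I_eq]
  exact (boldP_pos hroots hr (Real.exp_pos _)).ne'

include hP hc0 hc1 hG

/-- The weight decays on the imaginary axis because `shiftedWeight` does on the line
`Re x = -1/2`, where `P` is bounded away from zero. -/
theorem exists_norm_cweight_le : ∃ C δ : ℝ, 0 < δ ∧
    ∀ y : ℝ, ‖cweight P c G (y * I)‖ ≤ C * Real.exp (-(δ * |y|)) := by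
  obtain ⟨C, δ, hδ, h⟩ := stripDecay_shiftedWeight hr hc0 hc1 hG
  obtain ⟨b, hb, h'⟩ := exists_le_norm_prod_sub hr
  refine ⟨C / b, δ, hδ, fun y => ?_⟩
  have h1 := h (y * I - 1 / 2) (by simp [abs_of_pos])
  have h2 := h' (y * I - 1 / 2) (by simp)
  rw [shiftedWeight_sub_half hP hr hroots, norm_mul, eval_eq_prod_sub_roots hP] at h1
  rw [div_mul_eq_mul_div, le_div_iff₀ hb, mul_comm]
  refine (mul_le_mul_of_nonneg_right h2 (norm_nonneg _)).trans (h1.trans ?_)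
  simp

theorem integrable_eval_mul_cweight (R : ℂ[X]) :
    Integrable fun y : ℝ => R.eval (y * I) * cweight P c G (y * I) := by
  obtain ⟨C, δ, hδ, h⟩ := exists_norm_cweight_le hP hr hroots hc0 hc1 hG
  have := integrable_eval_mul_of_le hδ
    (continuous_cweight hr hroots c G).aestronglyMeasurable h (R.comp (X * Polynomial.C I))
  simpa [mul_comm I] using this

omit hP hroots in
theorem integral_eval_mul_shiftedWeight_eq (R : ℂ[X]) {a b : ℝ} (ha : |a| ≤ 1 / 2)
    (hb : |b| ≤ 1 / 2) : ∫ y : ℝ, R.eval (a + y * I) * shiftedWeight P c G (a + y * I) =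
      ∫ y : ℝ, R.eval (b + y * I) * shiftedWeight P c G (b + y * I) :=
  integral_vertical_eq ((stripDecay_shiftedWeight hr hc0 hc1 hG).eval_mul R)
    (R.differentiable.differentiableOn.mul (differentiableOn_shiftedWeight hr c G)) ha hb

end

end Weight

/-! ### Twisted traces given by weights -/

section TraceFunctional

open MeasureTheory Complex Filter Topology
open scoped Real ComplexOrder ComplexConjugate

variable {P : ℂ[X]}

theorem cweight_add (P : ℂ[X]) (c : ℝ) (G H : ℂ[X]) (x : ℂ) :
    cweight P c (G + H) x = cweight P c G x + cweight P c H x := by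
  simp only [cweight, eval_add]
  ring

theorem cweight_smul (P : ℂ[X]) (c : ℝ) (r : ℂ) (G : ℂ[X]) (x : ℂ) :
    cweight P c (r • G) x = r * cweight P c G x := by
  simp only [cweight, eval_smul, smul_eq_mul]
  ring

/-- The functional `R ↦ ∫ R(x) w(x) |dx|` over the imaginary axis. -/
def weightFunctional (P : ℂ[X]) (c : ℝ) (G : ℂ[X])
    (h : ∀ R : ℂ[X], Integrable fun y : ℝ => R.eval (y * I) * cweight P c G (y * I)) :
    ℂ[X] →ₗ[ℂ] ℂ where
  toFun R := ∫ y : ℝ, R.eval (y * I) * cweight P c G (y * I)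
  map_add' R S := by
    rw [← integral_add (h R) (h S)]
    congr 1 with y
    rw [eval_add, add_mul]
  map_smul' r R := by
    rw [RingHom.id_apply, smul_eq_mul, ← integral_const_mul]
    congr 1 with y
    rw [eval_smul, smul_eq_mul, mul_assoc]

section

variable (hP : P.Monic) (hr : ∀ α ∈ P.roots, |α.re| < 1 / 2)
  (hroots : P.roots.map (fun α => -conj α) = P.roots)
  {c : ℝ} (hc0 : 0 ≤ c) (hc1 : c < 1) {G : ℂ[X]} (hG : IsAdmissible P.roots.card c G)
include hP hr hroots hc0 hc1 hG

/-- Shifting the contour by one unit turns `w(x + 1) = t w(x)` into the trace condition. -/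
theorem isTraceFunctional_weightFunctional : IsTraceFunctional P (tOf c)
    (weightFunctional P c G (integrable_eval_mul_cweight hP hr hroots hc0 hc1 hG)) := by
  intro S
  have h := integral_eval_mul_shiftedWeight_eq hr hc0 hc1 hG (S.comp (X - C (1 / 2)))
    (a := -(1 / 2)) (b := 1 / 2) (by simp [abs_of_pos]) (by simp [abs_of_pos])
  have e1 : ∀ y : ℝ, ((-(1 / 2) : ℝ) : ℂ) + y * I = y * I - 1 / 2 := fun y => by push_cast; ring
  have e2 : ∀ y : ℝ, ((1 / 2 : ℝ) : ℂ) + y * I = y * I + 1 / 2 := fun y => by push_cast; ring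
  simp only [e1, e2, shiftedWeight_sub_half hP hr hroots, shiftedWeight_add_half hP hr hroots] at h
  simp only [weightFunctional, LinearMap.coe_mk, AddHom.coe_mk]
  rw [← integral_const_mul]
  refine (integral_congr_ae (.of_forall fun y => ?_)).trans
    (h.trans (integral_congr_ae (.of_forall fun y => ?_)))
  · simp only [eval_mul, eval_comp, eval_sub, eval_X, eval_C, eval_one]
    rw [sub_sub, add_halves]
    ring
  · simp only [eval_mul, eval_comp, eval_sub, eval_add, eval_X, eval_C]
    rw [add_sub_cancel_right]
    ring

/-- The value of the trace on `(R v) ρ(R v)`, up to the factor `λ`. On the line `Re x = 0` the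
shifted polynomials become complex conjugates of each other. -/
theorem weightFunctional_weight_one (R : ℂ[X]) :
    weightFunctional P c G (integrable_eval_mul_cweight hP hr hroots hc0 hc1 hG)
      (R * ((skewConj R).comp (X - 1) * P.comp (X - C (1 / 2)))) =
    ∫ y : ℝ, (‖R.eval (y * I + 1 / 2)‖ ^ 2 : ℝ) * shiftedWeight P c G (y * I) := by
  have h := integral_eval_mul_shiftedWeight_eq hr hc0 hc1 hG
    (R.comp (X + C (1 / 2)) * (skewConj R).comp (X - C (1 / 2)))
    (a := -(1 / 2)) (b := 0) (by simp [abs_of_pos]) (by simp)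
  have e1 : ∀ y : ℝ, ((-(1 / 2) : ℝ) : ℂ) + y * I = y * I - 1 / 2 := fun y => by push_cast; ring
  simp only [e1, ofReal_zero, zero_add, shiftedWeight_sub_half hP hr hroots] at h
  simp only [weightFunctional, LinearMap.coe_mk, AddHom.coe_mk]
  refine (integral_congr_ae (.of_forall fun y => ?_)).trans
    (h.trans (integral_congr_ae (.of_forall fun y => ?_)))
  · simp only [eval_mul, eval_comp, eval_sub, eval_add, eval_X, eval_C, eval_one]
    rw [sub_sub, add_halves, sub_add_cancel]
    ring
  · simp only [eval_mul, eval_comp, eval_sub, eval_add, eval_X, eval_C, eval_skewConj]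
    have e3 : -conj (y * I - 1 / 2 : ℂ) = y * I + 1 / 2 := by
      simp [map_ofNat]; ring
    rw [e3, mul_conj, normSq_eq_norm_sq]

/-- The weight is determined by its moments, and vanishes only if `G` vanishes on the positive
half-line, which is the image of the imaginary axis under `e^{2πix}`. -/
theorem eq_zero_of_weightFunctional_eq_zero
    (h : ∀ R : ℂ[X], ∫ y : ℝ, R.eval (y * I) * cweight P c G (y * I) = 0) : G = 0 := by
  obtain ⟨C₀, δ, hδ, hb⟩ := exists_norm_cweight_le hP hr hroots hc0 hc1 hG
  have hcont := continuous_cweight hr hroots c G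
  have h0 := ae_eq_zero_of_moments_eq_zero (half_pos hδ) hcont.aestronglyMeasurable
    (integrable_exp_mul_of_le (half_lt_self hδ) hcont.aestronglyMeasurable hb) fun k => by
      rw [← h ((C (-I) * X) ^ k)]
      congr 1 with y
      rw [eval_pow, eval_mul, eval_C, eval_X]
      congr 2
      linear_combination (y : ℂ) * I_sq
  have h1 : (fun y : ℝ => cweight P c G (y * I)) = fun _ => 0 :=
    (hcont.ae_eq_iff_eq volume continuous_const).1 h0
  have h2 : ∀ y : ℝ, G.eval (Real.exp y : ℂ) = 0 := fun y => by
    have h3 := congrFun h1 (-(y / (2 * π)))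
    have h4 := (boldP_pos hroots hr (Real.exp_pos y)).ne'
    have e : -(2 * π * -(y / (2 * π))) = y := by field_simp
    rw [cweight, exp_mul_I_eq, e, div_eq_zero_iff, or_iff_left h4, mul_eq_zero] at h3
    exact h3.resolve_left (Complex.exp_ne_zero _)
  refine eq_zero_of_infinite_isRoot G (Set.Infinite.mono (s := Set.range
    fun y : ℝ => (Real.exp y : ℂ)) ?_ (Set.infinite_range_of_injective
      (Complex.ofReal_injective.comp Real.exp_injective)))
  rintro _ ⟨y, rfl⟩
  exact h2 y

end

/-! ### Every twisted trace is given by a weight -/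

theorem coeff_taylor_of_natDegree_le {F : ℂ[X]} {d : ℕ} (hF : F.natDegree ≤ d + 1) (r : ℂ) :
    (taylor r F).coeff d = F.coeff d + (d + 1) * F.coeff (d + 1) * r := by
  have h1 : (hasseDeriv d F).natDegree ≤ 1 := (natDegree_hasseDeriv_le F d).trans (by omega)
  rw [taylor_coeff, eval_eq_sum_range' (Nat.lt_succ_of_le h1)]
  simp [Finset.sum_range_succ, hasseDeriv_coeff, add_comm 1 d]

/-- The difference `F(x - 1/2) - t F(x + 1/2)` has the same degree as `F` if `t ≠ 1`, and drops
the degree by exactly one if `t = 1`. -/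
theorem degree_difference {F : ℂ[X]} (hF : F.Monic) {t : ℂ} {m e : ℕ}
    (he : e = if t = 1 then 1 else 0) (hd : F.natDegree = m + e) :
    (F.comp (X + C (-(1 / 2))) - C t * F.comp (X + C (1 / 2))).natDegree ≤ m ∧
    (F.comp (X + C (-(1 / 2))) - C t * F.comp (X + C (1 / 2))).coeff m ≠ 0 := by
  have hmon : ∀ a : ℂ, (F.comp (X + C a)).coeff F.natDegree = 1 := fun a => by
    have := (hF.comp_X_add_C a).coeff_natDegree
    rwa [natDegree_comp, natDegree_X_add_C, mul_one] at this
  have hle : ∀ a : ℂ, (F.comp (X + C a)).natDegree ≤ F.natDegree := fun a => by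
    rw [natDegree_comp, natDegree_X_add_C, mul_one]
  have hle' : (F.comp (X + C (-(1 / 2))) - C t * F.comp (X + C (1 / 2))).natDegree
      ≤ F.natDegree :=
    (natDegree_sub_le _ _).trans (max_le (hle _) ((natDegree_C_mul_le _ _).trans (hle _)))
  by_cases ht : t = 1
  · rw [if_pos ht] at he
    subst he ht
    constructor
    · rw [natDegree_le_iff_coeff_eq_zero]
      intro N hN
      rcases eq_or_lt_of_le (Nat.succ_le_of_lt hN) with h | h
      · rw [← h, Nat.succ_eq_add_one, ← hd]
        rw [coeff_sub, C_1, one_mul, hmon, hmon, sub_self]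
      · exact coeff_eq_zero_of_natDegree_lt (lt_of_le_of_lt hle' (by omega))
    · have h1 : F.coeff (m + 1) = 1 := by rw [← hd]; exact hF.coeff_natDegree
      rw [C_1, one_mul, coeff_sub, ← taylor_apply, ← taylor_apply,
        coeff_taylor_of_natDegree_le hd.le, coeff_taylor_of_natDegree_le hd.le, h1]
      have : (m : ℂ) + 1 ≠ 0 := Nat.cast_add_one_ne_zero m
      intro h2
      apply this
      linear_combination -h2
  · rw [if_neg ht] at he
    subst he
    rw [add_zero] at hd
    refine ⟨hd ▸ hle', ?_⟩
    rw [← hd, coeff_sub, coeff_C_mul, hmon, hmon, mul_one]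
    exact sub_ne_zero.2 (Ne.symm ht)

/-- A trace functional is determined by its values on polynomials of degree less than `n`, or less
than `n - 1` if `t = 1`: the relations it annihilates have one leading term in each higher
degree. -/
theorem IsTraceFunctional.eq_zero (hP : P.Monic) {t : ℂˣ} {τ : ℂ[X] →ₗ[ℂ] ℂ}
    (hτ : IsTraceFunctional P t τ) {e : ℕ} (he : e = if (t : ℂ) = 1 then 1 else 0)
    (h : ∀ R : ℂ[X], R.degree < ((P.natDegree - e : ℕ) : WithBot ℕ) → τ R = 0) : τ = 0 := by
  suffices H : ∀ m : ℕ, ∀ R : ℂ[X], R.degree < (m : WithBot ℕ) → τ R = 0 by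
    refine LinearMap.ext fun R => ?_
    exact H (R.natDegree + 1) R (degree_lt_iff_coeff_zero _ _ |>.2 fun N hN =>
      coeff_eq_zero_of_natDegree_lt hN)
  intro m
  induction m with
  | zero =>
    intro R hR
    have : R = 0 := by simpa using hR
    rw [this, map_zero]
  | succ m ih =>
    intro R hR
    by_cases hm : m + 1 ≤ P.natDegree - e
    · exact h R (hR.trans_le (by exact_mod_cast hm))
    · -- the relation for `x ^ (m + e - n)` has degree `m`; subtract a multiple of it from `R`
      set S : ℂ[X] := (X ^ (m + e - P.natDegree)).comp (X + C (1 / 2)) with hS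
      have hF : (X ^ (m + e - P.natDegree) * P).Monic := (monic_X_pow _).mul hP
      have hd : (X ^ (m + e - P.natDegree) * P).natDegree = m + e := by
        rw [(monic_X_pow _).natDegree_mul hP, natDegree_X_pow]
        omega
      obtain ⟨h1, h2⟩ := degree_difference hF he hd
      set N := (X ^ (m + e - P.natDegree) * P).comp (X + C (-(1 / 2))) -
        C (t : ℂ) * (X ^ (m + e - P.natDegree) * P).comp (X + C (1 / 2)) with hN
      have hN0 : τ N = 0 := by
        have h3 := hτ S
        have e1 : S.comp (X - 1) = (X ^ (m + e - P.natDegree)).comp (X + C (-(1 / 2))) := by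
          rw [hS, comp_assoc]
          congr 1
          rw [add_comp, X_comp, C_comp, sub_add, ← C_1, ← C_sub, sub_eq_add_neg, ← C_neg]
          norm_num
        rw [e1, hS, sub_eq_add_neg X, ← C_neg, ← mul_comp, ← mul_comp] at h3
        rw [hN, map_sub, h3, ← smul_eq_C_mul, map_smul, smul_eq_mul, sub_self]
      have h4 := ih (R - (R.coeff m / N.coeff m) • N) (by
        rw [degree_lt_iff_coeff_zero]
        intro k hk
        rw [coeff_sub, coeff_smul, smul_eq_mul]
        rcases eq_or_lt_of_le hk with rfl | hk
        · rw [div_mul_cancel₀ _ h2, sub_self]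
        · rw [degree_lt_iff_coeff_zero] at hR
          rw [hR k hk, coeff_eq_zero_of_natDegree_lt (lt_of_le_of_lt h1 hk)]
          simp)
      rwa [map_sub, map_smul, hN0, smul_zero, sub_zero] at h4

theorem tOf_eq_one_iff {c : ℝ} (hc0 : 0 ≤ c) (hc1 : c < 1) : (tOf c : ℂ) = 1 ↔ c = 0 := by
  rw [tOf, Units.val_mk0]
  constructor
  · intro h
    obtain ⟨n, hn⟩ := Complex.exp_eq_one_iff.1 h
    have h3 : (2 * π * I : ℂ) ≠ 0 := by simp [Real.pi_ne_zero]
    rw [mul_comm (n : ℂ)] at hn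
    have h4 : (c : ℂ) = n := mul_left_cancel₀ h3 hn
    have h5 : c = n := by exact_mod_cast h4
    rw [h5] at hc0 hc1
    have h6 : (0 : ℤ) ≤ n := by exact_mod_cast hc0
    have h7 : n < (1 : ℤ) := by exact_mod_cast hc1
    rw [h5, show n = 0 by omega, Int.cast_zero]
  · rintro rfl
    simp

section

variable (hP : P.Monic) (hr : ∀ α ∈ P.roots, |α.re| < 1 / 2)
  (hroots : P.roots.map (fun α => -conj α) = P.roots)
  {c : ℝ} (hc0 : 0 ≤ c) (hc1 : c < 1)
include hP hr hroots hc0 hc1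

/-- Every trace functional is given by a weight: functionals given by weights form a space of
dimension at least that of all trace functionals. -/
theorem exists_weightFunctional_eq {τ : ℂ[X] →ₗ[ℂ] ℂ}
    (hτ : IsTraceFunctional P (tOf c) τ) :
    ∃ G : ℂ[X], IsAdmissible P.roots.card c G ∧
      ∀ R : ℂ[X], τ R = ∫ y : ℝ, R.eval (y * I) * cweight P c G (y * I) := by
  have hcard : P.roots.card = P.natDegree := IsAlgClosed.card_roots_eq_natDegree
  -- for `t = 1` the trace condition leaves one parameter less, matching the condition `G(0) = 0`,
  -- which is imposed by the factor `X ^ e`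
  set e : ℕ := if (tOf c : ℂ) = 1 then 1 else 0 with he
  have he1 : e ≤ 1 := by rw [he]; split_ifs <;> simp
  set k := P.natDegree - e with hk
  have hadm : ∀ G : degreeLT ℂ k, IsAdmissible P.roots.card c (X ^ e * (G : ℂ[X])) := by
    rintro ⟨G, hG⟩
    rw [mem_degreeLT] at hG
    constructor
    · rw [hcard]
      rw [degree_lt_iff_coeff_zero] at hG ⊢
      intro N hN
      rw [coeff_X_pow_mul']
      split_ifs
      · exact hG _ (by omega)
      · rfl
    · intro hc
      have : e = 1 := by rw [he, if_pos ((tOf_eq_one_iff hc0 hc1).2 hc)]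
      simp [this]
  have hint := fun G => integrable_eval_mul_cweight hP hr hroots hc0 hc1 (hadm G)
  let L : degreeLT ℂ k →ₗ[ℂ] Module.Dual ℂ (degreeLT ℂ k) :=
    { toFun := fun G => weightFunctional P c _ (hint G) ∘ₗ (degreeLT ℂ k).subtype
      map_add' := fun G H => by
        ext R
        simp only [LinearMap.comp_apply, LinearMap.add_apply, weightFunctional, LinearMap.coe_mk,
          AddHom.coe_mk, Submodule.coe_add, mul_add, cweight_add]
        exact integral_add (hint G _) (hint H _)
      map_smul' := fun r G => by
        ext R
        simp only [LinearMap.comp_apply, LinearMap.smul_apply, weightFunctional, LinearMap.coe_mk,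
          AddHom.coe_mk, Submodule.coe_smul, mul_smul_comm, cweight_smul, RingHom.id_apply,
          smul_eq_mul]
        rw [← integral_const_mul]
        congr 1 with y
        ring }
  have hL : Function.Injective L := by
    rw [← LinearMap.ker_eq_bot, LinearMap.ker_eq_bot']
    intro G hG
    have h1 := (isTraceFunctional_weightFunctional hP hr hroots hc0 hc1 (hadm G)).eq_zero hP he
      fun R hR => LinearMap.congr_fun hG ⟨R, mem_degreeLT.2 hR⟩
    have h2 := eq_zero_of_weightFunctional_eq_zero hP hr hroots hc0 hc1 (hadm G)
      (LinearMap.congr_fun h1)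
    rw [mul_eq_zero] at h2
    exact Subtype.ext (h2.resolve_left (pow_ne_zero _ X_ne_zero))
  have : FiniteDimensional ℂ (degreeLT ℂ k) := (degreeLTEquiv ℂ k).symm.finiteDimensional
  have hsurj : Function.Surjective L :=
    (LinearMap.injective_iff_surjective_of_finrank_eq_finrank
      Subspace.dual_finrank_eq.symm).1 hL
  obtain ⟨G, hG⟩ := hsurj (τ ∘ₗ (degreeLT ℂ k).subtype)
  refine ⟨_, hadm G, fun R => ?_⟩
  have hτ' : IsTraceFunctional P (tOf c) (τ - weightFunctional P c _ (hint G)) := fun S => by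
    rw [LinearMap.sub_apply, LinearMap.sub_apply, hτ S,
      isTraceFunctional_weightFunctional hP hr hroots hc0 hc1 (hadm G) S, mul_sub]
  have h0 := hτ'.eq_zero hP he fun R hR => by
    have := LinearMap.congr_fun hG ⟨R, mem_degreeLT.2 hR⟩
    rw [LinearMap.sub_apply, sub_eq_zero]
    exact this.symm
  have := LinearMap.congr_fun h0 R
  rw [LinearMap.sub_apply, LinearMap.zero_apply, sub_eq_zero] at this
  exact this

end

end TraceFunctional

/-! ### Real weights and their signs -/

section Cones

open MeasureTheory Complex Filter Topology
open scoped Real ComplexOrder ComplexConjugate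

variable {P : ℂ[X]}

theorem integrable_normSq_mul {w : ℝ → ℝ} (hw : Continuous w) {C δ : ℝ} (hδ : 0 < δ)
    (hC : ∀ y, |w y| ≤ C * Real.exp (-(δ * |y|))) (Q : ℂ[X]) :
    Integrable fun y : ℝ => ‖Q.eval (y : ℂ)‖ ^ 2 * w y := by
  have h1 := integrable_eval_mul_of_le (f := fun y : ℝ => (w y : ℂ)) hδ (by fun_prop)
    (by simpa using hC) (Q * Q.map (starRingEnd ℂ))
  have h2 : ∀ y : ℝ, (Q * Q.map (starRingEnd ℂ)).eval (y : ℂ) * (w y : ℂ) =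
      ((‖Q.eval (y : ℂ)‖ ^ 2 * w y : ℝ) : ℂ) := fun y => by
    have h3 := eval_map_apply (p := Q) (f := starRingEnd ℂ) (y : ℂ)
    rw [conj_ofReal] at h3
    rw [eval_mul, h3, mul_conj, normSq_eq_norm_sq]
    push_cast
    ring
  simp only [h2] at h1
  exact h1.re

theorem integral_normSq_mul_pos {w : ℝ → ℝ} (hw : Continuous w) {C δ : ℝ} (hδ : 0 < δ)
    (hC : ∀ y, |w y| ≤ C * Real.exp (-(δ * |y|))) (h0 : ∀ y, 0 ≤ w y)
    (hfin : {y | w y = 0}.Finite) {Q : ℂ[X]} (hQ : Q ≠ 0) :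
    0 < ∫ y : ℝ, ‖Q.eval (y : ℂ)‖ ^ 2 * w y := by
  have hfin' : {y : ℝ | Q.eval (y : ℂ) = 0}.Finite :=
    (finite_setOfPred_isRoot hQ).preimage Complex.ofReal_injective.injOn
  obtain ⟨y, hy⟩ := (hfin.union hfin').exists_notMem
  rw [Set.mem_union, not_or] at hy
  refine integral_pos_of_integrable_nonneg_nonzero (by fun_prop)
    (integrable_normSq_mul hw hδ hC Q)
    (fun y => mul_nonneg (by positivity) (h0 y)) (x := y) ?_
  exact mul_ne_zero (pow_ne_zero 2 (norm_ne_zero_iff.2 hy.2)) hy.1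

/-- A real polynomial, regarded as a complex one. -/
abbrev toComplex (G : ℝ[X]) : ℂ[X] := G.map (algebraMap ℝ ℂ)

theorem eval_toComplex (G : ℝ[X]) (x : ℝ) : (toComplex G).eval (x : ℂ) = ((G.eval x : ℝ) : ℂ) :=
  eval_map_apply (f := algebraMap ℝ ℂ) x

theorem isAdmissible_of_mem {n : ℕ} {c : ℝ} {ε : ℤˣ} {G : ℝ[X]} (hG : G ∈ polyCone n c ε) :
    IsAdmissible n c (toComplex G) := by
  refine ⟨degree_map_le.trans_lt hG.2.1, fun h => ?_⟩
  have := eval_toComplex G 0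
  rw [hG.2.2.1 h] at this
  simpa using this

theorem exists_pos_ofReal_eq {a : ℂ} (ha : 0 < a) : ∃ b : ℝ, 0 < b ∧ a = b := by
  rw [Complex.pos_iff] at ha
  exact ⟨a.re, ha.1, Complex.ext rfl (by simpa using ha.2.symm)⟩

/-- For real `G`, the weight on the imaginary axis is real with the sign of `G` on the positive
half-line. -/
theorem cweight_toComplex (hr : ∀ α ∈ P.roots, |α.re| < 1 / 2)
    (hroots : P.roots.map (fun α => -conj α) = P.roots) (c : ℝ) (y : ℝ) :
    ∃ p : ℝ, 0 < p ∧ ∀ G : ℝ[X], cweight P c (toComplex G) (y * I) =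
      ((p * G.eval (Real.exp (-(2 * π * y))) : ℝ) : ℂ) := by
  obtain ⟨b, hb, h⟩ := exists_pos_ofReal_eq (boldP_pos hroots hr (Real.exp_pos (-(2 * π * y))))
  refine ⟨Real.exp (-(2 * π * c * y)) / b, div_pos (Real.exp_pos _) hb, fun G => ?_⟩
  rw [cweight, exp_mul_I_eq, h, eval_toComplex, exp_mul_mul_I_eq]
  push_cast
  ring

theorem cweight_conj (hr : ∀ α ∈ P.roots, |α.re| < 1 / 2)
    (hroots : P.roots.map (fun α => -conj α) = P.roots) (c : ℝ) (G : ℂ[X]) (y : ℝ) :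
    cweight P c (G.map (starRingEnd ℂ)) (y * I) = conj (cweight P c G (y * I)) := by
  obtain ⟨b, hb, h⟩ := exists_pos_ofReal_eq (boldP_pos hroots hr (Real.exp_pos (-(2 * π * y))))
  have h2 := eval_map_apply (p := G) (f := starRingEnd ℂ) (Real.exp (-(2 * π * y)) : ℂ)
  rw [conj_ofReal] at h2
  rw [cweight, cweight, exp_mul_I_eq, h, exp_mul_mul_I_eq, h2, map_div₀, map_mul,
    conj_ofReal, conj_ofReal]

/-- For real `G`, the function `λ P(x) w(x + 1/2)` on the imaginary axis is real with the sign of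
`ε G` on the negative half-line. -/
theorem lam_mul_shiftedWeight_toComplex (hr : ∀ α ∈ P.roots, |α.re| < 1 / 2)
    (hroots : P.roots.map (fun α => -conj α) = P.roots) {c : ℝ} {lam : ℂ} {ε : ℤˣ}
    (hε : I ^ P.roots.card * cexp (π * I * c) * lam = ((ε : ℤ) : ℂ)) (y : ℝ) :
    ∃ p : ℝ, 0 < p ∧ ∀ G : ℝ[X], lam * shiftedWeight P c (toComplex G) (y * I) =
      ((p * ((ε : ℤ) * G.eval (-Real.exp (-(2 * π * y)))) : ℝ) : ℂ) := by
  obtain ⟨b, hb, h⟩ := exists_pos_ofReal_eq (rootProd_pos hroots hr y)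
  refine ⟨Real.exp (-(2 * π * c * y)) * b, mul_pos (Real.exp_pos _) hb, fun G => ?_⟩
  have h1 : cexp (2 * π * I * c * (y * I + 1 / 2)) =
      (Real.exp (-(2 * π * c * y)) : ℂ) * cexp (π * I * c) := by
    rw [ofReal_exp, ← Complex.exp_add]
    congr 1
    push_cast
    linear_combination (2 * π * c * y : ℂ) * I_sq
  have h2 : rootProd P (y * I) = I ^ P.roots.card * b := by
    rw [← h, ← mul_assoc, ← mul_pow]
    simp
  have h3 := eval_toComplex G (-Real.exp (-(2 * π * y)))
  rw [shiftedWeight, exp_mul_I_eq, ← ofReal_neg, h3, h1, h2]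
  push_cast
  rw [← hε]
  ring

theorem eval_mul_I (R : ℂ[X]) (y : ℝ) :
    (R.comp (Polynomial.C I * X)).eval (y : ℂ) = R.eval (y * I) := by
  rw [eval_comp, eval_mul, eval_C, eval_X, mul_comm]

theorem finite_setOf_eval_eq_zero {G : ℝ[X]} (hG : G ≠ 0) {f : ℝ → ℝ} (hf : Function.Injective f) :
    {y | G.eval (f y) = 0}.Finite :=
  (finite_setOfPred_isRoot hG).preimage hf.injOn

theorem injective_exp_neg : Function.Injective fun y : ℝ => Real.exp (-(2 * π * y)) := by
  refine Real.exp_injective.comp fun x y h => ?_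
  have : (2 * π : ℝ) ≠ 0 := by positivity
  exact mul_left_cancel₀ this (neg_injective h)

theorem exists_exp_neg_eq {x : ℝ} (hx : 0 < x) : ∃ y : ℝ, Real.exp (-(2 * π * y)) = x := by
  refine ⟨-(Real.log x / (2 * π)), ?_⟩
  have e : -(2 * π * -(Real.log x / (2 * π))) = Real.log x := by field_simp
  rw [e, Real.exp_log hx]

section

variable (hP : P.Monic) (hr : ∀ α ∈ P.roots, |α.re| < 1 / 2)
  (hroots : P.roots.map (fun α => -conj α) = P.roots)
  {c : ℝ} (hc0 : 0 ≤ c) (hc1 : c < 1)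
include hP hr hroots hc0 hc1

/-- The values of a trace on `R ρ(R)` for `R ∈ ℂ[z]` are integrals of `|R|²` against a density `w`
with the sign of `G` on the positive half-line. The polynomials are written in the real coordinate
`y` of `x = iy`. -/
theorem exists_density_trace_weight_zero {G : ℝ[X]} (hG : IsAdmissible P.roots.card c (toComplex G))
    (ρ : Conjugation P) {T : QAlg P →ₗ[ℂ] ℂ}
    (hT : ∀ R : ℂ[X], T (aeval (z P) R) =
      ∫ y : ℝ, R.eval (y * I) * cweight P c (toComplex G) (y * I)) :
    ∃ w : ℝ → ℝ, Continuous w ∧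
      (∃ C δ : ℝ, 0 < δ ∧ ∀ y, |w y| ≤ C * Real.exp (-(δ * |y|))) ∧
      (∀ y, ∃ p : ℝ, 0 < p ∧ w y = p * G.eval (Real.exp (-(2 * π * y)))) ∧
      ∀ R : ℂ[X], T (aeval (z P) R * ρ (aeval (z P) R)) =
        ((∫ y : ℝ, ‖(R.comp (C I * X)).eval (y : ℂ)‖ ^ 2 * w y : ℝ) : ℂ) := by
  have hreal : ∀ y : ℝ, cweight P c (toComplex G) (y * I) =
      ((cweight P c (toComplex G) (y * I)).re : ℂ) := fun y => by
    obtain ⟨p, -, h⟩ := cweight_toComplex hr hroots c y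
    rw [h, ofReal_re]
  obtain ⟨C₀, δ, hδ, hb⟩ := exists_norm_cweight_le hP hr hroots hc0 hc1 hG
  refine ⟨fun y => (cweight P c (toComplex G) (y * I)).re,
    continuous_re.comp (continuous_cweight hr hroots c _),
    ⟨C₀, δ, hδ, fun y => (abs_re_le_norm _).trans (hb y)⟩, fun y => ?_, fun R => ?_⟩
  · obtain ⟨p, hp, h⟩ := cweight_toComplex hr hroots c y
    exact ⟨p, hp, by beta_reduce; rw [h, ofReal_re]⟩
  · rw [aeval_mul_conjugation, hT, ← integral_complex_ofReal]
    congr 1 with y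
    rw [eval_mul, skewConj_eval_ofReal_mul_I, mul_conj, normSq_eq_norm_sq, hreal, eval_mul_I]
    push_cast
    rfl

/-- The values of a trace on `(R v) ρ(R v)` for `R ∈ ℂ[z]` are integrals of `|R(x + 1/2)|²` against
a density `w` with the sign of `ε G` on the negative half-line. -/
theorem exists_density_trace_weight_one {G : ℝ[X]} (hG : IsAdmissible P.roots.card c (toComplex G))
    (ρ : Conjugation P) {ε : ℤˣ}
    (hε : I ^ P.roots.card * cexp (π * I * c) * ρ.lam = ((ε : ℤ) : ℂ)) {T : QAlg P →ₗ[ℂ] ℂ}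
    (hT : ∀ R : ℂ[X], T (aeval (z P) R) =
      ∫ y : ℝ, R.eval (y * I) * cweight P c (toComplex G) (y * I)) :
    ∃ w : ℝ → ℝ, Continuous w ∧
      (∃ C δ : ℝ, 0 < δ ∧ ∀ y, |w y| ≤ C * Real.exp (-(δ * |y|))) ∧
      (∀ y, ∃ p : ℝ, 0 < p ∧ w y = p * ((ε : ℤ) * G.eval (-Real.exp (-(2 * π * y))))) ∧
      ∀ R : ℂ[X], T (aeval (z P) R * v P * ρ (aeval (z P) R * v P)) =
        ((∫ y : ℝ, ‖((R.comp (X + C (1 / 2))).comp (C I * X)).eval (y : ℂ)‖ ^ 2 * w y : ℝ) :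
          ℂ) := by
  set W : ℝ → ℂ := fun y => ρ.lam * shiftedWeight P c (toComplex G) (y * I) with hW
  have hreal : ∀ y : ℝ, W y = ((W y).re : ℂ) := fun y => by
    obtain ⟨p, -, h⟩ := lam_mul_shiftedWeight_toComplex hr hroots hε y
    rw [hW]
    beta_reduce
    rw [h, ofReal_re]
  obtain ⟨C₀, δ, hδ, hb⟩ := stripDecay_shiftedWeight hr hc0 hc1 hG
  have hcont : Continuous W := by
    have := continuous_vertical (a := 0)
      (differentiableOn_shiftedWeight hr c (toComplex G)).continuousOn (by simp)
    simp only [ofReal_zero, zero_add] at this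
    exact continuous_const.mul this
  refine ⟨fun y => (W y).re, continuous_re.comp hcont,
    ⟨‖ρ.lam‖ * C₀, δ, hδ, fun y => (abs_re_le_norm _).trans ?_⟩, fun y => ?_, fun R => ?_⟩
  · rw [hW, norm_mul, mul_assoc]
    gcongr
    simpa using hb (y * I) (by simp)
  · obtain ⟨p, hp, h⟩ := lam_mul_shiftedWeight_toComplex hr hroots hε y
    refine ⟨p, hp, ?_⟩
    rw [hW]
    beta_reduce
    rw [h, ofReal_re]
  · rw [aeval_mul_v_mul_conjugation, map_smul, hT, smul_eq_mul,
      show ∫ y : ℝ, _ * cweight P c (toComplex G) (y * I) = _ from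
        weightFunctional_weight_one hP hr hroots hc0 hc1 hG R, ← integral_const_mul,
      ← integral_complex_ofReal]
    congr 1 with y
    rw [ofReal_mul, ← hreal, eval_mul_I, eval_comp, eval_add, eval_X, eval_C, hW]
    ring

/-- A polynomial in the cone defines a positive trace. -/
theorem exists_positiveTrace {ρ : Conjugation P}
    (hρ : ∀ a, ρ (ρ a) = twist P (tOf c) a) {ε : ℤˣ}
    (hε : I ^ P.roots.card * cexp (π * I * c) * ρ.lam = ((ε : ℤ) : ℂ)) {G : ℝ[X]}
    (hG : G ∈ polyCone P.roots.card c ε) :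
    ∃ T ∈ positiveTraces ρ (tOf c), ∀ R : ℂ[X], T (aeval (z P) R) =
      ∫ y : ℝ, R.eval (y * I) * cweight P c (toComplex G) (y * I) := by
  have hadm := isAdmissible_of_mem hG
  obtain ⟨hG0, -, -, hm, hp⟩ := hG
  have hP0 := hP.ne_zero
  set τ := weightFunctional P c _ (integrable_eval_mul_cweight hP hr hroots hc0 hc1 hadm) with hτ
  have hτt := isTraceFunctional_weightFunctional hP hr hroots hc0 hc1 hadm
  have hT := isTwistedTrace_extendTrace hP0 hτt
  have hTR : ∀ R : ℂ[X], extendTrace hP0 τ (aeval (z P) R) =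
      ∫ y : ℝ, R.eval (y * I) * cweight P c (toComplex G) (y * I) := fun R =>
    extendTrace_aeval hP0 τ R
  have hpos : ∀ x : ℝ, 0 < x → 0 ≤ G.eval x := fun x hx => by
    rcases Int.units_eq_one_or ε with h | h
    · exact hp h x
    · exact (hm h).1 x hx
  have hneg : ∀ x : ℝ, 0 < x → 0 ≤ (ε : ℤ) * G.eval (-x) := fun x hx => by
    rcases Int.units_eq_one_or ε with h | h
    · rw [h]; simpa using hp h (-x)
    · rw [h]; simpa using (hm h).2 (-x) (by linarith)
  have hε0 : ((ε : ℤ) : ℝ) ≠ 0 := by exact_mod_cast ε.ne_zero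
  have hI : (C I * X : ℂ[X]).natDegree ≠ 0 := by
    rw [natDegree_C_mul_X _ I_ne_zero]; exact one_ne_zero
  have hcomp : ∀ R : ℂ[X], R ≠ 0 → R.comp (C I * X) ≠ 0 := fun R hR h => by
    rcases comp_eq_zero_iff.1 h with h | ⟨-, h⟩
    · exact hR h
    · rw [h, natDegree_C] at hI; exact hI rfl
  refine ⟨extendTrace hP0 τ, ⟨hT, trace_conjugation hT.z_comm ρ fun R => ?_, fun a ha => ?_⟩, hTR⟩
  · rw [hTR, hTR, ← integral_conj]
    congr 1 with y
    obtain ⟨p, -, h⟩ := cweight_toComplex hr hroots c y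
    rw [skewConj_eval_ofReal_mul_I, map_mul, h, conj_ofReal]
  · have h := trace_mul_conjugation_pos hP0 hT hρ (fun R hR => ?_) (fun R hR => ?_) ha
    · rw [Complex.pos_iff] at h
      exact ⟨h.1, h.2.symm⟩
    · obtain ⟨w, hw, ⟨C₀, δ, hδ, hb⟩, hwp, hwT⟩ :=
        exists_density_trace_weight_zero hP hr hroots hc0 hc1 hadm ρ hTR
      rw [hwT]
      refine Complex.zero_lt_real.2 (integral_normSq_mul_pos hw hδ hb (fun y => ?_) ?_ (hcomp R hR))
      · obtain ⟨p, hp, h⟩ := hwp y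
        rw [h]
        exact mul_nonneg hp.le (hpos _ (Real.exp_pos _))
      · refine (finite_setOf_eval_eq_zero hG0 injective_exp_neg).subset fun y hy => ?_
        obtain ⟨p, hp, h⟩ := hwp y
        rw [Set.mem_ofPred_eq, h] at hy
        exact (mul_eq_zero.1 hy).resolve_left hp.ne'
    · obtain ⟨w, hw, ⟨C₀, δ, hδ, hb⟩, hwp, hwT⟩ :=
        exists_density_trace_weight_one hP hr hroots hc0 hc1 hadm ρ hε hTR
      rw [hwT]
      refine Complex.zero_lt_real.2 (integral_normSq_mul_pos hw hδ hb (fun y => ?_) ?_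
        (hcomp _ (comp_X_add_C_ne_zero hR _)))
      · obtain ⟨p, hp, h⟩ := hwp y
        rw [h]
        exact mul_nonneg hp.le (hneg _ (Real.exp_pos _))
      · refine (finite_setOf_eval_eq_zero hG0
          (neg_injective.comp injective_exp_neg)).subset fun y hy => ?_
        obtain ⟨p, hp, h⟩ := hwp y
        rw [Set.mem_ofPred_eq, h] at hy
        exact (mul_eq_zero.1 ((mul_eq_zero.1 hy).resolve_left hp.ne')).resolve_left hε0

/-- The integrals against polynomials determine `G`. -/
theorem eq_of_integral_eq {G H : ℂ[X]} (hG : IsAdmissible P.roots.card c G)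
    (hH : IsAdmissible P.roots.card c H)
    (h : ∀ R : ℂ[X], ∫ y : ℝ, R.eval (y * I) * cweight P c G (y * I) =
      ∫ y : ℝ, R.eval (y * I) * cweight P c H (y * I)) : G = H := by
  have hadm : IsAdmissible P.roots.card c (G + (-1 : ℂ) • H) := by
    refine ⟨(degree_add_le _ _).trans_lt (max_lt hG.1 ((degree_smul_le _ _).trans_lt hH.1)),
      fun hc => ?_⟩
    simp [hG.2 hc, hH.2 hc]
  have h0 := eq_zero_of_weightFunctional_eq_zero hP hr hroots hc0 hc1 hadm fun R => by
    have h1 := integrable_eval_mul_cweight hP hr hroots hc0 hc1 hG R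
    have h2 := integrable_eval_mul_cweight hP hr hroots hc0 hc1 hH R
    rw [← sub_eq_zero.2 (h R), ← integral_sub h1 h2]
    congr 1 with y
    rw [cweight_add, cweight_smul]
    ring
  rw [neg_one_smul] at h0
  exact add_neg_eq_zero.1 h0

/-- Every positive trace comes from a polynomial in the cone. -/
theorem exists_mem_polyCone {ρ : Conjugation P} {ε : ℤˣ}
    (hε : I ^ P.roots.card * cexp (π * I * c) * ρ.lam = ((ε : ℤ) : ℂ))
    {T : QAlg P →ₗ[ℂ] ℂ} (hT : T ∈ positiveTraces ρ (tOf c)) :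
    ∃ G ∈ polyCone P.roots.card c ε, ∀ R : ℂ[X], T (aeval (z P) R) =
      ∫ y : ℝ, R.eval (y * I) * cweight P c (toComplex G) (y * I) := by
  obtain ⟨htr, hconj, hpos⟩ := hT
  have htr : IsTwistedTrace (tOf c) T := htr
  obtain ⟨G', hG', hTG'⟩ :=
    exists_weightFunctional_eq hP hr hroots hc0 hc1 htr.isTraceFunctional
  simp only [LinearMap.comp_apply, AlgHom.toLinearMap_apply] at hTG'
  -- equivariance under `ρ` forces real coefficients
  have hreal : G'.map (starRingEnd ℂ) = G' := by
    refine eq_of_integral_eq hP hr hroots hc0 hc1 ⟨degree_map_le.trans_lt hG'.1, fun hc => ?_⟩ hG'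
      fun R => ?_
    · have := eval_map_apply (p := G') (f := starRingEnd ℂ) 0
      rw [map_zero, hG'.2 hc, map_zero] at this
      exact this
    · rw [← hTG', ← conj_conj (T _), ← hconj, ρ.map_aeval, hTG', ← integral_conj]
      congr 1 with y
      rw [map_mul, skewConj_eval_ofReal_mul_I, conj_conj, cweight_conj hr hroots]
  obtain ⟨G, rfl⟩ : ∃ G : ℝ[X], toComplex G = G' := by
    have h : G' ∈ lifts (algebraMap ℝ ℂ) := by
      rw [lifts_iff_coeff_lifts]
      intro k
      have h1 := congrArg (fun p : ℂ[X] => p.coeff k) hreal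
      simp only [coeff_map] at h1
      exact ⟨(G'.coeff k).re, conj_eq_iff_re.1 h1⟩
    exact (mem_lifts _).1 h
  have hI : (C (-I) * X : ℂ[X]).comp (C I * X) = X := by
    rw [mul_comp, C_comp, X_comp, ← mul_assoc, ← C_mul]
    simp
  have hG0 : ∀ x : ℝ, 0 < x → 0 ≤ G.eval x := fun x hx => by
    obtain ⟨w, hw, ⟨C₀, δ, hδ, hb⟩, hwp, hwT⟩ :=
      exists_density_trace_weight_zero hP hr hroots hc0 hc1 hG' ρ hTG'
    have h0 := nonneg_of_integral_normSq_mul_nonneg hw hδ hb fun R => by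
      rcases eq_or_ne (aeval (z P) (R.comp (C (-I) * X))) 0 with h | h
      · have h1 := hwT (R.comp (C (-I) * X))
        rw [h, zero_mul, map_zero, comp_assoc, hI, comp_X] at h1
        exact (ofReal_eq_zero.1 h1.symm).ge
      · have h1 := (hpos _ h).1.le
        rwa [hwT, comp_assoc, hI, comp_X, ofReal_re] at h1
    obtain ⟨y, rfl⟩ := exists_exp_neg_eq hx
    obtain ⟨p, hp, h⟩ := hwp y
    have := h0 y
    rw [h] at this
    exact nonneg_of_mul_nonneg_right this hp
  have hG1 : ∀ x : ℝ, 0 < x → 0 ≤ (ε : ℤ) * G.eval (-x) := fun x hx => by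
    obtain ⟨w, hw, ⟨C₀, δ, hδ, hb⟩, hwp, hwT⟩ :=
      exists_density_trace_weight_one hP hr hroots hc0 hc1 hG' ρ hε hTG'
    have h0 := nonneg_of_integral_normSq_mul_nonneg hw hδ hb fun R => by
      have hS : (((R.comp (C (-I) * X)).comp (X + C (-(1 / 2)))).comp (X + C (1 / 2))).comp
          (C I * X) = R := by
        rw [comp_assoc (R.comp _), add_comp, X_comp, C_comp, add_assoc, ← C_add, add_neg_cancel,
          C_0, add_zero, comp_X, comp_assoc, hI, comp_X]
      rcases eq_or_ne (aeval (z P) ((R.comp (C (-I) * X)).comp (X + C (-(1 / 2)))) * v P) 0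
        with h | h
      · have h1 := hwT ((R.comp (C (-I) * X)).comp (X + C (-(1 / 2))))
        rw [h, zero_mul, map_zero, hS] at h1
        exact (ofReal_eq_zero.1 h1.symm).ge
      · have h1 := (hpos _ h).1.le
        rwa [hwT, hS, ofReal_re] at h1
    obtain ⟨y, rfl⟩ := exists_exp_neg_eq hx
    obtain ⟨p, hp, h⟩ := hwp y
    have := h0 y
    rw [h] at this
    exact nonneg_of_mul_nonneg_right this hp
  refine ⟨G, ⟨?_, ?_, fun hc => ?_, fun h => ⟨hG0, fun x hx => ?_⟩, fun h x => ?_⟩, hTG'⟩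
  · rintro rfl
    have h1 : (1 : QAlg P) ≠ 0 := fun h => by
      have := aeval_z_injective hP.ne_zero (a₁ := 1) (a₂ := 0) (by simpa using h)
      exact one_ne_zero this
    have h2 := (hpos 1 h1).1
    rw [ρ.map_one, mul_one] at h2
    have h3 := hTG' 1
    rw [map_one] at h3
    rw [h3] at h2
    simp [cweight] at h2
  · exact (degree_map_eq_of_injective (algebraMap ℝ ℂ).injective G).symm.trans_lt hG'.1
  · have h1 := eval_toComplex G 0
    rw [ofReal_zero, hG'.2 hc] at h1
    exact ofReal_eq_zero.1 h1.symm
  · have := hG1 (-x) (by linarith)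
    rw [h, neg_neg] at this
    simpa using this
  · rcases lt_trichotomy x 0 with hx | rfl | hx
    · have := hG1 (-x) (by linarith)
      rw [h, neg_neg] at this
      simpa using this
    · -- the value at zero is the limit from the right
      have hlim : Tendsto (fun x => G.eval x) (𝓝[>] 0) (𝓝 (G.eval 0)) :=
        G.continuous.continuousAt.continuousWithinAt
      exact ge_of_tendsto hlim (eventually_nhdsWithin_of_forall hG0)
    · exact hG0 x hx

end

end Cones

/-! ### Isomorphisms of cones -/

section Isomorphisms

open MeasureTheory Complex
open scoped Real ComplexConjugate

variable {P : ℂ[X]}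

/-- A bijective correspondence between cones that respects addition and multiplication by positive
real numbers is an isomorphism. -/
theorem exists_coneIso {E F : Type*} [AddCommGroup E] [Module ℝ E] [AddCommGroup F] [Module ℝ F]
    {K : ConvexCone ℝ E} {L : ConvexCone ℝ F} (r : E → F → Prop)
    (hex : ∀ x ∈ K, ∃ y ∈ L, r x y)
    (huniq : ∀ x ∈ K, ∀ y ∈ L, ∀ y' ∈ L, r x y → r x y' → y = y')
    (hex' : ∀ y ∈ L, ∃ x ∈ K, r x y)
    (huniq' : ∀ y ∈ L, ∀ x ∈ K, ∀ x' ∈ K, r x y → r x' y → x = x')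
    (hadd : ∀ x y x' y', r x y → r x' y' → r (x + x') (y + y'))
    (hsmul : ∀ (s : ℝ) x y, r x y → r (s • x) (s • y)) :
    ∃ Φ : ConeIso K L, ∀ x, r x.1 (Φ.toEquiv x).1 := by
  choose f hfL hf using fun x : {x // x ∈ K} => hex x.1 x.2
  choose g hgK hg using fun y : {y // y ∈ L} => hex' y.1 y.2
  refine ⟨⟨⟨fun x => ⟨f x, hfL x⟩, fun y => ⟨g y, hgK y⟩, fun x => Subtype.ext ?_,
    fun y => Subtype.ext ?_⟩, fun x y => ?_, fun s hs x => ?_⟩, hf⟩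
  · exact huniq' _ (hfL x) _ (hgK _) _ x.2 (hg ⟨f x, hfL x⟩) (hf x)
  · exact huniq _ (hgK y) _ (hfL _) _ y.2 (hf ⟨g y, hgK y⟩) (hg y)
  · exact huniq _ (K.add_mem x.2 y.2) _ (hfL _) _ (L.add_mem (hfL x) (hfL y))
      (hf ⟨x.1 + y.1, K.add_mem x.2 y.2⟩)
      (hadd _ _ _ _ (hf x) (hf y))
  · exact huniq _ (K.smul_mem hs x.2) _ (hfL _) _ (L.smul_mem hs (hfL x))
      (hf ⟨s • x.1, K.smul_mem hs x.2⟩)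
      (hsmul s _ _ (hf x))

variable {ρ : Conjugation P} {t : ℂˣ}

theorem form_apply_eq {B : SesqForm P} (hB : B ∈ positiveForms ρ) (a b : QAlg P) :
    B a b = B (a * ρ b) 1 := by
  rw [hB.2.1, mul_one]

/-- The trace `a ↦ (a, 1)` attached to a form. -/
def formTrace (B : SesqForm P) : QAlg P →ₗ[ℂ] ℂ := B.flip 1

theorem formTrace_mem (hρ : ∀ a, ρ (ρ a) = twist P t a) {B : SesqForm P}
    (hB : B ∈ positiveForms ρ) : formTrace B ∈ positiveTraces ρ t := by
  have hconj : ∀ a, B (ρ a) 1 = conj (B a 1) := fun a => by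
    rw [← hB.1, ← one_mul (ρ a), hB.2.1, mul_one]
  refine ⟨fun a b => ?_, hconj, fun a ha => ?_⟩
  · change B (a * b) 1 = B (b * twist P t a) 1
    obtain ⟨b, rfl⟩ := ρ.toRingEquiv.surjective b
    rw [← form_apply_eq hB, hB.1 b a, form_apply_eq hB, ← hconj, ρ.map_mul, hρ]
  · change 0 < (B (a * ρ a) 1).re ∧ (B (a * ρ a) 1).im = 0
    rw [← form_apply_eq hB]
    exact ⟨hB.2.2 a ha, conj_eq_iff_im.1 (hB.1 a a).symm⟩

/-- The form `(a, b) = T(a ρ(b))` attached to a trace. -/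
def traceForm (ρ : Conjugation P) (T : QAlg P →ₗ[ℂ] ℂ) : SesqForm P :=
  LinearMap.mk₂'ₛₗ (RingHom.id ℂ) (starRingEnd ℂ) (fun a b => T (a * ρ b))
    (fun a a' b => by rw [add_mul, map_add])
    (fun r a b => by rw [smul_mul_assoc, map_smul, RingHom.id_apply])
    (fun a b b' => by rw [ρ.map_add, mul_add, map_add])
    (fun r a b => by rw [ρ.map_smul, mul_smul_comm, map_smul])

theorem traceForm_apply (T : QAlg P →ₗ[ℂ] ℂ) (a b : QAlg P) :
    traceForm ρ T a b = T (a * ρ b) := rfl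

theorem traceForm_apply_one (T : QAlg P →ₗ[ℂ] ℂ) (a : QAlg P) : traceForm ρ T a 1 = T a := by
  rw [traceForm_apply, ρ.map_one, mul_one]

theorem traceForm_mem (hρ : ∀ a, ρ (ρ a) = twist P t a) {T : QAlg P →ₗ[ℂ] ℂ}
    (hT : T ∈ positiveTraces ρ t) : traceForm ρ T ∈ positiveForms ρ := by
  obtain ⟨h1, h2, h3⟩ := hT
  refine ⟨fun a b => ?_, fun a b y => ?_, fun a ha => (h3 a ha).1⟩
  · rw [traceForm_apply, traceForm_apply, ← h2, ρ.map_mul, hρ, ← h1]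
  · rw [traceForm_apply, traceForm_apply, ρ.map_mul, mul_assoc]

theorem form_ext {B B' : SesqForm P} (hB : B ∈ positiveForms ρ) (hB' : B' ∈ positiveForms ρ)
    (h : ∀ a, B a 1 = B' a 1) : B = B' := by
  refine LinearMap.ext fun a => LinearMap.ext fun b => ?_
  rw [form_apply_eq hB, form_apply_eq hB', h]

/-- Forms correspond to traces through `T(a) = (a, 1)` and `(a, b) = T(a ρ(b))`. -/
theorem exists_coneIso_forms_traces (hρ : ∀ a, ρ (ρ a) = twist P t a) :
    ∃ Ψ : ConeIso (positiveForms ρ) (positiveTraces ρ t),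
      (∀ B a, (Ψ.toEquiv B).1 a = B.1 a 1) ∧
      (∀ T a b, (Ψ.toEquiv.symm T).1 a b = T.1 (a * ρ b)) := by
  obtain ⟨Ψ, hΨ⟩ := exists_coneIso (K := positiveForms ρ) (L := positiveTraces ρ t)
    (fun B T => ∀ a, T a = B a 1)
    (fun B hB => ⟨formTrace B, formTrace_mem hρ hB, fun a => rfl⟩)
    (fun B _ T _ T' _ h h' => LinearMap.ext fun a => by rw [h, h'])
    (fun T hT => ⟨traceForm ρ T, traceForm_mem hρ hT, fun a => (traceForm_apply_one T a).symm⟩)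
    (fun T _ B hB B' hB' h h' => form_ext hB hB' fun a => by rw [← h, h'])
    (fun B T B' T' h h' a => by simp [h a, h' a])
    (fun s B T h a => by simp [h a])
  refine ⟨Ψ, hΨ, fun T a b => ?_⟩
  rw [form_apply_eq (Ψ.toEquiv.symm T).2, ← hΨ, Equiv.apply_symm_apply]

/-- Forms correspond to polynomials `G` through `(R(z), 1) = ∫ R(x) w(x) |dx|`. -/
theorem exists_coneIso_forms_polynomials (hP : P.Monic) (hr : ∀ α ∈ P.roots, |α.re| < 1 / 2)
    {c : ℝ} (hc0 : 0 ≤ c) (hc1 : c < 1) (hρ : ∀ a, ρ (ρ a) = twist P (tOf c) a) {ε : ℤˣ}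
    (hε : I ^ P.roots.card * cexp (π * I * c) * ρ.lam = ((ε : ℤ) : ℂ)) :
    ∃ Φ : ConeIso (positiveForms ρ) (polyCone P.roots.card c ε),
      ∀ (B : {B // B ∈ positiveForms ρ}) (R : ℂ[X]),
        Integrable (fun y : ℝ => R.eval ((y : ℂ) * I) *
          weight P c (Φ.toEquiv B).1 ((y : ℂ) * I)) ∧
        B.1 (aeval (z P) R) 1 =
          ∫ y : ℝ, R.eval ((y : ℂ) * I) * weight P c (Φ.toEquiv B).1 ((y : ℂ) * I) := by
  have hroots := ρ.map_neg_conj_roots hP.ne_zero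
  simp only [weight_eq_cweight]
  have hint : ∀ G ∈ polyCone P.roots.card c ε, ∀ R : ℂ[X],
      Integrable fun y : ℝ => R.eval (y * I) * cweight P c (toComplex G) (y * I) := fun G hG =>
    integrable_eval_mul_cweight hP hr hroots hc0 hc1 (isAdmissible_of_mem hG)
  refine exists_coneIso (K := positiveForms ρ) (L := polyCone P.roots.card c ε)
    (fun (B : SesqForm P) (G : ℝ[X]) => ∀ R : ℂ[X],
      Integrable (fun y : ℝ => R.eval (y * I) * cweight P c (toComplex G) (y * I)) ∧
      B (aeval (z P) R) 1 = ∫ y : ℝ, R.eval (y * I) * cweight P c (toComplex G) (y * I))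
    (fun B hB => ?_) (fun B _ G hG G' hG' h h' => ?_) (fun G hG => ?_)
    (fun G _ B hB B' hB' h h' => ?_) (fun B G B' G' h h' R => ?_) (fun s B G h R => ?_)
  · obtain ⟨G, hG, h⟩ := exists_mem_polyCone hP hr hroots hc0 hc1 hε (formTrace_mem hρ hB)
    exact ⟨G, hG, fun R => ⟨hint G hG R, h R⟩⟩
  · exact map_injective _ (algebraMap ℝ ℂ).injective (eq_of_integral_eq hP hr hroots hc0 hc1
      (isAdmissible_of_mem hG) (isAdmissible_of_mem hG') fun R => by rw [← (h R).2, (h' R).2])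
  · obtain ⟨T, hT, h⟩ := exists_positiveTrace hP hr hroots hc0 hc1 hρ hε hG
    exact ⟨traceForm ρ T, traceForm_mem hρ hT, fun R =>
      ⟨hint G hG R, (traceForm_apply_one T _).trans (h R)⟩⟩
  · have h1 : IsTwistedTrace (tOf c) (formTrace B) := (formTrace_mem hρ hB).1
    have h2 : IsTwistedTrace (tOf c) (formTrace B') := (formTrace_mem hρ hB').1
    have h3 := trace_ext h1.z_comm h2.z_comm fun R => (h R).2.trans (h' R).2.symm
    exact form_ext hB hB' fun a => LinearMap.congr_fun h3 a
  · have e : ∀ y : ℝ, R.eval (y * I) * cweight P c (toComplex (G + G')) (y * I) =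
        R.eval (y * I) * cweight P c (toComplex G) (y * I) +
        R.eval (y * I) * cweight P c (toComplex G') (y * I) := fun y => by
      rw [toComplex, Polynomial.map_add, cweight_add, mul_add]
    simp only [e]
    refine ⟨(h R).1.add (h' R).1, ?_⟩
    rw [integral_add (h R).1 (h' R).1, ← (h R).2, ← (h' R).2]
    simp
  · have e : ∀ y : ℝ, R.eval (y * I) * cweight P c (toComplex (s • G)) (y * I) =
        s * (R.eval (y * I) * cweight P c (toComplex G) (y * I)) := fun y => by
      have : toComplex (s • G) = (s : ℂ) • toComplex G := by
        rw [toComplex, Polynomial.map_smul]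
        rfl
      rw [this, cweight_smul]
      ring
    simp only [e]
    refine ⟨(h R).1.const_mul _, ?_⟩
    rw [integral_const_mul, ← (h R).2]
    simp

end Isomorphisms

end Kleinian

end

theorem mainTheorem1 (n : ℕ) (hn : 1 ≤ n) (P : Polynomial ℂ) (hmonic : P.Monic)
    (hdeg : P.natDegree = n) (hroots : ∀ α : ℂ, P.IsRoot α → |α.re| < 1 / 2)
    (ρ : Kleinian.Conjugation P) (c : ℝ) (hc0 : 0 ≤ c) (hc1 : c < 1)
    (hρ : ∀ a, ρ (ρ a) = Kleinian.twist P (Kleinian.tOf c) a)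
    (ε : ℤˣ)
    (hε : Complex.I ^ n * Complex.exp (Real.pi * Complex.I * c) * ρ.lam = ((ε : ℤ) : ℂ)) :
    (∃ Ψ : Kleinian.ConeIso (Kleinian.positiveForms ρ)
        (Kleinian.positiveTraces ρ (Kleinian.tOf c)),
      (∀ B a, (Ψ.toEquiv B).1 a = B.1 a 1) ∧
      (∀ T a b, (Ψ.toEquiv.symm T).1 a b = T.1 (a * ρ b))) ∧
    (∃ Φ : Kleinian.ConeIso (Kleinian.positiveForms ρ) (Kleinian.polyCone n c ε),
      ∀ (B : {B // B ∈ Kleinian.positiveForms ρ}) (R : Polynomial ℂ),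
        MeasureTheory.Integrable (fun y : ℝ =>
          R.eval ((y : ℂ) * Complex.I)
            * Kleinian.weight P c (Φ.toEquiv B).1 ((y : ℂ) * Complex.I)) ∧
        B.1 (Polynomial.aeval (Kleinian.z P) R) 1 =
          ∫ y : ℝ, R.eval ((y : ℂ) * Complex.I)
            * Kleinian.weight P c (Φ.toEquiv B).1 ((y : ℂ) * Complex.I)) := by
  have hcard : P.roots.card = n :=
    (IsAlgClosed.card_roots_eq_natDegree (p := P)).trans hdeg
  subst hcard
  exact ⟨Kleinian.exists_coneIso_forms_traces hρ,
    Kleinian.exists_coneIso_forms_polynomials hmonic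
      (fun α hα => hroots α (isRoot_of_mem_roots hα)) hc0 hc1 hρ hε⟩
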